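/- Let $P_n$ be the undirected path with vertex set $\{1,\dots,n\}$ and edges $\{i,i+1\}$, $1\le i\le n-1$. Let $\mathrm{IEnd}(P_n)$ be the monoid, under composition (maps written on the right), of all injective partial transformations $\alpha$ of $\{1,\dots,n\}$ that map any two adjacent vertices of their domain to adjacent vertices, and let $\mathrm{PAut}(P_n)$ be the submonoid of those $\alpha\in\mathrm{IEnd}(P_n)$ with $\alpha^{-1}\in\mathrm{IEnd}(P_n)$. The rank of a monoid is the least number of elements of a generating set. Then the rank of $\mathrm{IEnd}(P_3)$ is $4$ and, for every $n\ge 4$, the rank of $\mathrm{IEnd}(P_n)$ is $n+\lceil n/2\rceil-2$. Moreover, let $n\ge3$, let $\tau$ be the map $x\mapsto n+1-x$, for $1\le i\le n$ let $\alpha_i$ be the map with domain $\{1,\dots,n\}\setminus\{i\}$ such that $x\mapsto x$ for $x<i$ and $x\mapsto n+i+1-x$ for $x>i$, and for $2\le i\le n-1$ let $\beta_i$ be the map with domain $\{1,\dots,n\}\setminus\{i\}$ such that $x\mapsto x$ for $x<i$ and $x\mapsto x-1$ for $x>i$. Put $\mathcal A=\{\tau,\alpha_1,\alpha_2\}$ if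 $n=3$ and $\mathcal A=\{\tau\}\cup\{\alpha_i: 1\le i\le n-2\}$ if $n\ge4$. Then $\mathcal B=\mathcal A\cup\{\beta_i: 2\le i\le\lceil n/2\rceil\}$ is a generating set of $\mathrm{IEnd}(P_n)$ of minimal size. Furthermore, for every generating set $G'$ of $\mathrm{IEnd}(P_n)$, the set $G'\cap \mathrm{PAut}(P_n)$ generates $\mathrm{PAut}(P_n)$, and $G'$ contains at least $\lceil n/2\rceil-1$ elements that are not in $\mathrm{PAut}(P_n)$. -/

import Mathlib

/-- The symmetric inverse monoid on `V`: injective partial transformations of `V`, with maps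
written on the right, so that `f * g` means first `f`, then `g`; the unit is the identity map. -/
instance symmetricInverseMonoid (V : Type*) : Monoid (V ≃. V) where
  mul f g := f.trans g
  one := PEquiv.refl V
  mul_assoc f g h := PEquiv.trans_assoc f g h
  one_mul f := PEquiv.refl_trans f
  mul_one f := PEquiv.trans_refl f

/-- The injective partial transformation `f` of the vertices of `G` is a partial endomorphism:
it maps adjacent vertices of its domain to adjacent vertices. Here `u' ∈ f u` says that `f` is
defined at `u` with value `u'`. -/
def IsPartialEnd {V : Type*} (G : SimpleGraph V) (f : V ≃. V) : Prop :=
  ∀ ⦃u v u' v' : V⦄, u' ∈ f u → v' ∈ f v → G.Adj u v → G.Adj u' v'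

theorem isPartialEnd_one {V : Type*} (G : SimpleGraph V) : IsPartialEnd G (1 : V ≃. V) := by
  intro u v u' v' hu hv h
  obtain rfl : u = u' := Option.some.inj hu
  obtain rfl : v = v' := Option.some.inj hv
  exact h

theorem IsPartialEnd.mul {V : Type*} {G : SimpleGraph V} {f g : V ≃. V}
    (hf : IsPartialEnd G f) (hg : IsPartialEnd G g) : IsPartialEnd G (f * g) := by
  intro u v u'' v'' hu hv h
  obtain ⟨u', hu₁, hu₂⟩ := (PEquiv.mem_trans f g u u'').1 hu
  obtain ⟨v', hv₁, hv₂⟩ := (PEquiv.mem_trans f g v v'').1 hv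
  exact hg hu₂ hv₂ (hf hu₁ hv₁ h)

/-- The monoid `IEnd(G)` of all injective partial endomorphisms of the graph `G`. -/
def IEnd {V : Type*} (G : SimpleGraph V) : Submonoid (V ≃. V) where
  carrier := {f | IsPartialEnd G f}
  mul_mem' hf hg := IsPartialEnd.mul hf hg
  one_mem' := isPartialEnd_one G

/-- The monoid `PAut(G)` of all partial automorphisms of the graph `G`: the injective partial
transformations `f` such that `f` and its inverse are both partial endomorphisms. -/
def PAut {V : Type*} (G : SimpleGraph V) : Submonoid (V ≃. V) where
  carrier := {f | IsPartialEnd G f ∧ IsPartialEnd G f.symm}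
  mul_mem' hf hg := ⟨IsPartialEnd.mul hf.1 hg.1, IsPartialEnd.mul hg.2 hf.2⟩
  one_mem' := ⟨isPartialEnd_one G, isPartialEnd_one G⟩

/-- The rank of a monoid: the least number of elements of a generating set
(`⊤` if there is no finite one). -/
noncomputable def monoidRank (M : Type*) [Monoid M] : ℕ∞ :=
  ⨅ (S : Set M) (_ : Submonoid.closure S = ⊤), S.encard

/-! The vertices `1, …, n` of the path are represented by `Fin n`: the vertex with label `x` is
the element `v : Fin n` with `v.val + 1 = x`. -/

/-- The reflection `τ : x ↦ n + 1 - x`. -/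
def pathTau (n : ℕ) : Fin n ≃. Fin n := (Fin.revPerm : Equiv.Perm (Fin n)).toPEquiv

/-- The map `α_i`: undefined at `i`, it fixes every `x < i` and sends `x > i` to `n + i + 1 - x`
(in terms of labels), reversing the interval above `i`. -/
def pathAlpha {n : ℕ} (i : Fin n) : Fin n ≃. Fin n where
  toFun v := if v < i then some v else if h : i < v then some ⟨n + i - v, by omega⟩ else none
  invFun v := if v < i then some v else if h : i < v then some ⟨n + i - v, by omega⟩ else none
  inv := by
    intro a b
    simp only [Option.mem_def, Fin.lt_def]
    split_ifs <;> simp [Fin.ext_iff] <;> omega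

/-- The map `β_i`: undefined at `i`, it fixes every `x < i` and sends `x > i` to `x - 1`. -/
def pathBeta {n : ℕ} (i : Fin n) : Fin n ≃. Fin n where
  toFun v := if v < i then some v else if h : i < v then some ⟨v - 1, by omega⟩ else none
  invFun v := if v < i then some v else if h : v.val + 1 < n then some ⟨v + 1, h⟩ else none
  inv := by
    intro a b
    simp only [Option.mem_def, Fin.lt_def]
    split_ifs <;> simp [Fin.ext_iff] <;> omega

/-- The set `𝒜`: it is `{τ, α_1, α_2}` if `n = 3`, and `{τ} ∪ {α_i | 1 ≤ i ≤ n - 2}` otherwise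
(it is used for `n ≥ 3` only). The index `i` has label `i.val + 1`. -/
def pathSetA (n : ℕ) : Set (Fin n ≃. Fin n) :=
  if n = 3 then {pathTau n} ∪ {f | ∃ i : Fin n, i.val + 1 ≤ 2 ∧ f = pathAlpha i}
  else {pathTau n} ∪ {f | ∃ i : Fin n, i.val + 1 ≤ n - 2 ∧ f = pathAlpha i}

/-- The set `ℬ = 𝒜 ∪ {β_i | 2 ≤ i ≤ ⌈n/2⌉}`. -/
def pathSetB (n : ℕ) : Set (Fin n ≃. Fin n) :=
  pathSetA n ∪
    {f | ∃ i : Fin n, 2 ≤ i.val + 1 ∧ i.val + 1 ≤ ⌈(n : ℚ) / 2⌉₊ ∧ f = pathBeta i}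

open SimpleGraph

/-! Vertices are numbered from 0 below, and ρ_s denotes `suffixReversal n s`: this is τ for s = 0
and an α_i otherwise.

Generation (`mem_of_admissible`). Suppose every pair of f with an entry below a is diagonal.
Multiplying f by reversals ρ_s with s ≥ a, one makes (a, a) a pair of f, or finds a outside both
domain and range; then a can be increased, and a partial identity remains at the end. Multiplication
by ρ_s loses nothing as long as s - 1 is outside the domain (on the left) or the range (on the
right). The one obstruction is that a - 1 is fixed while a is the image of some x > a. Then f makes
nonadjacent vertices adjacent, so f is not a partial automorphism, and a factor β_a is split off.
Thus reversals generate `PAut`, and together with the β_i they generate `IEnd`.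

Minimality. The only total elements are 1 and τ. In a product undefined at a single vertex no factor
restricts the later ones further, so if the product lies in `PAut`, all its factors do
(`mem_closure_inter_PAut`); hence G' ∩ `PAut` generates `PAut`. Partial automorphisms of corank one
preserve the missing vertex up to reflection, so generators can be counted by mirror classes {k,
n-1-k}. Every class of inner vertices needs a generator outside `PAut`, because of β_k. Inside
`PAut`, every class needs a generator, and two if 2 ≤ k < n-1-k: up to factors τ, the elements of
that class form a Klein four-group, which is not cyclic. One more generator must be total, to
produce τ. -/

theorem PEquiv.mem_mul_iff {V : Type*} {f g : V ≃. V} {x y : V} :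
    y ∈ (f * g) x ↔ ∃ z, z ∈ f x ∧ y ∈ g z :=
  PEquiv.mem_trans f g x y

theorem PEquiv.mem_one_iff {V : Type*} {x y : V} : y ∈ (1 : V ≃. V) x ↔ y = x := by
  change some x = some y ↔ _
  simp [eq_comm]

theorem PEquiv.ext_mem {V : Type*} {f g : V ≃. V} (h : ∀ x y, y ∈ f x ↔ y ∈ g x) : f = g :=
  PEquiv.ext fun x => Option.ext fun y => h x y

theorem PEquiv.mem_unique {V : Type*} {f : V ≃. V} {x y z : V} (h : y ∈ f x) (h' : z ∈ f x) :
    y = z := Option.mem_unique h h'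

theorem mem_pathTau {n : ℕ} {x y : Fin n} : y ∈ pathTau n x ↔ x.val + y.val + 1 = n := by
  simp only [pathTau, Equiv.toPEquiv_apply, Option.mem_def, Option.some.injEq, Fin.revPerm_apply,
    Fin.ext_iff, Fin.val_rev]
  omega

theorem mem_pathAlpha {n : ℕ} {i x y : Fin n} :
    y ∈ pathAlpha i x ↔ (x.val < i.val ∧ y.val = x.val) ∨
      (i.val < x.val ∧ x.val + y.val = n + i.val) := by
  change (if x < i then some x else if h : i < x then some ⟨n + i - x, by omega⟩ else none)
    = some y ↔ _
  simp only [Fin.lt_def]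
  split_ifs <;> simp [Fin.ext_iff] <;> omega

theorem mem_pathBeta {n : ℕ} {i x y : Fin n} :
    y ∈ pathBeta i x ↔ (x.val < i.val ∧ y.val = x.val) ∨
      (i.val < x.val ∧ y.val + 1 = x.val) := by
  change (if x < i then some x else if h : i < x then some ⟨x - 1, by omega⟩ else none)
    = some y ↔ _
  simp only [Fin.lt_def]
  split_ifs <;> simp [Fin.ext_iff] <;> omega

/-! ### Suffix reversals. -/

/-- The partial map that is undefined at `s - 1`, fixes every `x < s - 1` and reverses the
interval `s, …, n - 1`. -/
def suffixReversal (n s : ℕ) : Fin n ≃. Fin n where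
  toFun v := if v.val + 1 < s then some v else
    if h : s ≤ v.val then some ⟨n + s - 1 - v, by omega⟩ else none
  invFun v := if v.val + 1 < s then some v else
    if h : s ≤ v.val then some ⟨n + s - 1 - v, by omega⟩ else none
  inv := by
    intro a b
    split_ifs <;> simp [Fin.ext_iff] <;> omega

theorem mem_suffixReversal {n s : ℕ} {x y : Fin n} :
    y ∈ suffixReversal n s x ↔ (x.val + 1 < s ∧ y.val = x.val) ∨
      (s ≤ x.val ∧ x.val + y.val + 1 = n + s) := by
  change (if x.val + 1 < s then some x else
    if h : s ≤ x.val then some ⟨n + s - 1 - x, by omega⟩ else none) = some y ↔ _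
  split_ifs <;> simp [Fin.ext_iff] <;> omega

theorem suffixReversal_zero (n : ℕ) : suffixReversal n 0 = pathTau n :=
  PEquiv.ext_mem fun x y => by
    rw [mem_suffixReversal, mem_pathTau]; omega

theorem suffixReversal_succ {n : ℕ} (i : Fin n) :
    suffixReversal n (i.val + 1) = pathAlpha i :=
  PEquiv.ext_mem fun x y => by
    rw [mem_suffixReversal, mem_pathAlpha]; omega

theorem isPartialEnd_suffixReversal (n s : ℕ) :
    IsPartialEnd (pathGraph n) (suffixReversal n s) := by
  intro u v u' v' hu hv h
  rw [pathGraph_adj] at *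
  rw [mem_suffixReversal] at hu hv
  omega

theorem suffixReversal_mem_PAut (n s : ℕ) : suffixReversal n s ∈ PAut (pathGraph n) :=
  ⟨isPartialEnd_suffixReversal n s, isPartialEnd_suffixReversal n s⟩

theorem pathTau_mem_PAut (n : ℕ) : pathTau n ∈ PAut (pathGraph n) :=
  suffixReversal_zero n ▸ suffixReversal_mem_PAut n 0

theorem pathAlpha_mem_PAut {n : ℕ} (i : Fin n) : pathAlpha i ∈ PAut (pathGraph n) :=
  suffixReversal_succ i ▸ suffixReversal_mem_PAut n _

theorem isPartialEnd_pathBeta {n : ℕ} (i : Fin n) : pathBeta i ∈ IEnd (pathGraph n) := by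
  intro u v u' v' hu hv h
  rw [pathGraph_adj] at *
  rw [mem_pathBeta] at hu hv
  omega

theorem PAut_le_IEnd {V : Type*} (G : SimpleGraph V) : PAut G ≤ IEnd G := fun _ h => h.1

theorem suffixReversal_apply_ge {n s : ℕ} {x : Fin n} (h : s ≤ x.val) :
    ∃ y, y ∈ suffixReversal n s x ∧ x.val + y.val + 1 = n + s ∧ s ≤ y.val :=
  ⟨⟨n + s - 1 - x, by omega⟩, mem_suffixReversal.2 (Or.inr ⟨h, by simp only; omega⟩),
    by simp only; omega, by simp only; omega⟩

theorem suffixReversal_apply_lt {n s : ℕ} {x : Fin n} (h : x.val + 1 < s) :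
    x ∈ suffixReversal n s x := mem_suffixReversal.2 (Or.inl ⟨h, rfl⟩)

theorem exists_mem_suffixReversal {n s : ℕ} {x : Fin n} (h : x.val + 1 ≠ s) :
    ∃ y, y ∈ suffixReversal n s x := by
  rcases lt_or_ge (x.val + 1) s with h' | h'
  · exact ⟨x, suffixReversal_apply_lt h'⟩
  · obtain ⟨y, hy, -⟩ := suffixReversal_apply_ge (x := x) (s := s) (by omega)
    exact ⟨y, hy⟩

theorem mem_suffixReversal_comm {n s : ℕ} {x y : Fin n} :
    y ∈ suffixReversal n s x ↔ x ∈ suffixReversal n s y := by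
  rw [mem_suffixReversal, mem_suffixReversal]; omega

/-- A suffix reversal is an involution off `s - 1`, so it can be undone when `s - 1` is outside the
domain. -/
theorem suffixReversal_mul_cancel {n s : ℕ} {f : Fin n ≃. Fin n}
    (h : ∀ x y, y ∈ f x → x.val + 1 ≠ s) : suffixReversal n s * (suffixReversal n s * f) = f := by
  refine PEquiv.ext_mem fun x y => ?_
  simp only [PEquiv.mem_mul_iff]
  constructor
  · rintro ⟨z, hz, w, hw, hy⟩
    rwa [PEquiv.mem_unique (mem_suffixReversal_comm.1 hz) hw]
  · intro hy
    obtain ⟨z, hz⟩ := exists_mem_suffixReversal (h x y hy)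
    exact ⟨z, hz, x, mem_suffixReversal_comm.1 hz, hy⟩

theorem mul_suffixReversal_cancel {n s : ℕ} {f : Fin n ≃. Fin n}
    (h : ∀ x y, y ∈ f x → y.val + 1 ≠ s) : f * suffixReversal n s * suffixReversal n s = f := by
  refine PEquiv.ext_mem fun x y => ?_
  simp only [PEquiv.mem_mul_iff]
  constructor
  · rintro ⟨z, ⟨w, hw, hz⟩, hy⟩
    rwa [← PEquiv.mem_unique (mem_suffixReversal_comm.1 hz) hy]
  · intro hy
    obtain ⟨z, hz⟩ := exists_mem_suffixReversal (h x y hy)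
    exact ⟨z, ⟨y, hy, hz⟩, mem_suffixReversal_comm.1 hz⟩

/-- A partial identity is a product of squares of the maps `α_i`. -/
theorem mem_of_forall_eq {n : ℕ} {M : Submonoid (Fin n ≃. Fin n)}
    (hM : ∀ s, s ≤ n → suffixReversal n s ∈ M) {f : Fin n ≃. Fin n}
    (hf : ∀ x y, y ∈ f x → y = x) : f ∈ M := by
  classical
  have key : ∀ s : Finset (Fin n), PEquiv.ofSet {x | x ∉ s} ∈ M := by
    intro s
    induction s using Finset.induction_on with
    | empty =>
      convert M.one_mem
      refine PEquiv.ext_mem fun x y => ?_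
      rw [PEquiv.mem_one_iff, PEquiv.mem_ofSet_iff]
      simp [eq_comm]
    | insert i s his ih =>
      have hi := hM (i.val + 1) i.isLt
      convert M.mul_mem (M.mul_mem hi hi) ih using 1
      refine PEquiv.ext_mem fun x y => ?_
      simp only [PEquiv.mem_ofSet_iff, PEquiv.mem_mul_iff, Set.mem_ofPred_eq, Finset.mem_insert,
        not_or]
      constructor
      · rintro ⟨rfl, hx, hxs⟩
        obtain ⟨z, hz⟩ := exists_mem_suffixReversal (x := y) (s := i.val + 1)
          (fun h => hx (Fin.ext (by omega)))
        exact ⟨y, ⟨z, hz, mem_suffixReversal_comm.1 hz⟩, rfl, hxs⟩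
      · rintro ⟨z, ⟨w, hw, hz⟩, rfl, hxs⟩
        obtain rfl := PEquiv.mem_unique (mem_suffixReversal_comm.1 hw) hz
        refine ⟨rfl, ?_, hxs⟩
        rintro rfl
        rw [mem_suffixReversal] at hw
        omega
  convert key (Finset.univ.filter fun x => ∀ y, y ∉ f x)
  refine PEquiv.ext_mem fun x y => ?_
  simp only [PEquiv.mem_ofSet_iff, Set.mem_ofPred_eq, Finset.mem_filter, Finset.mem_univ, true_and,
    not_forall, not_not]
  constructor
  · intro h
    obtain rfl := hf x y h
    exact ⟨rfl, y, h⟩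
  · rintro ⟨rfl, z, hz⟩
    rwa [hf y z hz] at hz

/-! ### Reduction of a partial endomorphism to a partial identity. -/

/-- A partial endomorphism of the path that is a partial automorphism, unless `M` contains the
maps `β_i`. -/
def Admissible {n : ℕ} (M : Submonoid (Fin n ≃. Fin n)) (f : Fin n ≃. Fin n) : Prop :=
  IsPartialEnd (pathGraph n) f ∧
    (IsPartialEnd (pathGraph n) f.symm ∨ ∀ i : Fin n, 0 < i.val → pathBeta i ∈ M)

/-- The only pairs of `f` with an entry below `a` are diagonal. -/
def DiagonalBelow {n : ℕ} (a : ℕ) (f : Fin n ≃. Fin n) : Prop :=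
  ∀ x y : Fin n, x.val < a ∨ y.val < a → y ∈ f x → y = x

theorem Admissible.suffixReversal_mul {n : ℕ} {M : Submonoid (Fin n ≃. Fin n)}
    {f : Fin n ≃. Fin n} (h : Admissible M f) (s : ℕ) : Admissible M (suffixReversal n s * f) :=
  ⟨(isPartialEnd_suffixReversal n s).mul h.1,
    h.2.imp (fun h' => h'.mul (isPartialEnd_suffixReversal n s)) id⟩

theorem Admissible.mul_suffixReversal {n : ℕ} {M : Submonoid (Fin n ≃. Fin n)}
    {f : Fin n ≃. Fin n} (h : Admissible M f) (s : ℕ) : Admissible M (f * suffixReversal n s) :=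
  ⟨h.1.mul (isPartialEnd_suffixReversal n s),
    h.2.imp (fun h' => (isPartialEnd_suffixReversal n s).mul h') id⟩

theorem DiagonalBelow.suffixReversal_mul {n a s : ℕ} {f : Fin n ≃. Fin n}
    (h : DiagonalBelow a f) (has : a ≤ s) : DiagonalBelow a (suffixReversal n s * f) := by
  intro x y hxy hm
  obtain ⟨z, hz, hy⟩ := PEquiv.mem_mul_iff.1 hm
  rw [mem_suffixReversal] at hz
  have hzy := h z y
  rcases hxy with hx | hy'
  · have := hzy (Or.inl (by omega)) hy
    rw [Fin.ext_iff] at *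
    omega
  · have := hzy (Or.inr hy') hy
    rw [Fin.ext_iff] at *
    omega

theorem DiagonalBelow.mul_suffixReversal {n a s : ℕ} {f : Fin n ≃. Fin n}
    (h : DiagonalBelow a f) (has : a ≤ s) : DiagonalBelow a (f * suffixReversal n s) := by
  intro x y hxy hm
  obtain ⟨z, hz, hy⟩ := PEquiv.mem_mul_iff.1 hm
  rw [mem_suffixReversal] at hy
  have hxz := h x z
  rcases hxy with hx | hy'
  · have := hxz (Or.inl hx) hz
    rw [Fin.ext_iff] at *
    omega
  · have := hxz (Or.inr (by omega)) hz
    rw [Fin.ext_iff] at *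
    omega

theorem omits_suffixReversal_mul {n s t : ℕ} {f : Fin n ≃. Fin n} (hst : s ≤ t)
    (h : ∀ x y, y ∈ f x → x.val + 1 ≠ s) :
    ∀ x y, y ∈ (suffixReversal n t * f) x → x.val + 1 ≠ s := by
  intro x y hm hx
  obtain ⟨z, hz, hy⟩ := PEquiv.mem_mul_iff.1 hm
  rw [mem_suffixReversal] at hz
  exact h z y hy (by omega)

/-- The preimage `x` of `a` is moved to position `s`, where `F` applies. If `x - 1` is outside the
domain, ρ_x exchanges `x` with `n - 1`, and ρ_s then exchanges `n - 1` with `s`. If `x + 1` is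
outside the domain, a first use of ρ_s leads back to that case. Each reversal can be undone, since
the vertex it omits is outside the domain. -/
theorem mem_of_bring {n : ℕ} {M : Submonoid (Fin n ≃. Fin n)}
    (hM : ∀ s, s ≤ n → suffixReversal n s ∈ M) {a s : ℕ} (has : a ≤ s)
    (F : ∀ f, Admissible M f → DiagonalBelow a f → (∀ x y, y ∈ f x → x.val + 1 ≠ s) →
      ∀ x y : Fin n, x.val = s → y.val = a → y ∈ f x → f ∈ M)
    {f : Fin n ≃. Fin n} (hf : Admissible M f) (hd : DiagonalBelow a f)
    (hs : ∀ x y, y ∈ f x → x.val + 1 ≠ s) {x y : Fin n} (hy : y.val = a) (hsx : s ≤ x.val)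
    (hxy : y ∈ f x)
    (hend : (∀ z w, w ∈ f z → z.val ≠ x.val + 1) ∨ (∀ z w, w ∈ f z → z.val + 1 ≠ x.val)) :
    f ∈ M := by
  have reduce : ∀ {t} {f : Fin n ≃. Fin n}, t ≤ n → (∀ x y, y ∈ f x → x.val + 1 ≠ t) →
      suffixReversal n t * f ∈ M → f ∈ M := fun ht h hm =>
    suffixReversal_mul_cancel h ▸ M.mul_mem (hM _ ht) hm
  have last : ∀ {f : Fin n ≃. Fin n}, Admissible M f → DiagonalBelow a f →
      (∀ x y, y ∈ f x → x.val + 1 ≠ s) → ∀ x : Fin n, x.val + 1 = n → s ≤ x.val → y ∈ f x →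
      f ∈ M := by
    intro f hf hd hs x hx hsx hxy
    refine reduce (by omega) hs (F _ (hf.suffixReversal_mul s) (hd.suffixReversal_mul has)
      (omits_suffixReversal_mul le_rfl hs) ⟨s, by omega⟩ y rfl hy
      (PEquiv.mem_mul_iff.2 ⟨x, ?_, hxy⟩))
    rw [mem_suffixReversal]
    exact Or.inr ⟨le_rfl, by simp only; omega⟩
  have left : ∀ {f : Fin n ≃. Fin n}, Admissible M f → DiagonalBelow a f →
      (∀ x y, y ∈ f x → x.val + 1 ≠ s) → ∀ x : Fin n, s ≤ x.val → y ∈ f x →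
      (∀ z w, w ∈ f z → z.val + 1 ≠ x.val) → f ∈ M := by
    intro f hf hd hs x hsx hxy hend
    refine reduce (t := x.val) (by omega) hend (last (hf.suffixReversal_mul _)
      (hd.suffixReversal_mul (by omega)) (omits_suffixReversal_mul hsx hs)
      ⟨n - 1, by omega⟩ (by simp only; omega) (by simp only; omega)
      (PEquiv.mem_mul_iff.2 ⟨x, ?_, hxy⟩))
    rw [mem_suffixReversal]
    exact Or.inr ⟨by simp only; omega, by simp only; omega⟩
  rcases hend with hend | hend
  · obtain ⟨z, hz, hz', hz''⟩ := suffixReversal_apply_ge hsx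
    refine reduce (by omega) hs (left (hf.suffixReversal_mul s) (hd.suffixReversal_mul has)
      (omits_suffixReversal_mul le_rfl hs) z hz''
      (PEquiv.mem_mul_iff.2 ⟨x, mem_suffixReversal_comm.1 hz, hxy⟩) ?_)
    intro u w hm hu
    obtain ⟨v, hv, hw⟩ := PEquiv.mem_mul_iff.1 hm
    rw [mem_suffixReversal] at hv
    rcases hv with hv | hv
    · exact hs v w hw (by omega)
    · exact hend v w hw (by omega)
  · exact left hf hd hs x hsx hxy hend

/-- `Admissible` lets one induction, on `m = n - a`, serve both `PAut` and `IEnd`. -/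
theorem mem_of_admissible {n : ℕ} {M : Submonoid (Fin n ≃. Fin n)}
    (hM : ∀ s, s ≤ n → suffixReversal n s ∈ M) (m : ℕ) :
    ∀ (a : ℕ) (f : Fin n ≃. Fin n), a + m = n → Admissible M f → DiagonalBelow a f → f ∈ M := by
  induction m with
  | zero =>
    intro a f ha _ hd
    exact mem_of_forall_eq hM fun x y => hd x y (Or.inl (by omega))
  | succ m ih =>
    intro a f ha hf hd
    have fixed : ∀ f, Admissible M f → DiagonalBelow a f → ∀ x y : Fin n, x.val = a → y.val = a →
        y ∈ f x → f ∈ M := by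
      intro f hf hd x y hx hy hxy
      obtain rfl : x = y := Fin.ext (by omega)
      refine ih (a + 1) f (by omega) hf fun u v huv hm => ?_
      by_cases h : u.val < a ∨ v.val < a
      · exact hd u v h hm
      · by_cases hu : u = x
        · subst hu
          exact PEquiv.mem_unique hm hxy
        · by_cases hv : v = x
          · subst hv
            exact absurd (f.inj hm hxy) hu
          · rw [Fin.ext_iff] at hu hv
            omega
    have hit : ∀ f, Admissible M f → DiagonalBelow a f → ∀ x y : Fin n, y.val = a →
        y ∈ f x → f ∈ M := by
      intro f hf hd x y hy hxy
      rcases Nat.lt_trichotomy x.val a with hx | hx | hx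
      · have := hd x y (Or.inl hx) hxy
        rw [Fin.ext_iff] at this
        omega
      · exact fixed f hf hd x y hx hy hxy
      -- If both neighbours of `x` were in the domain, one of them would map to `a - 1`, hence be `a
      -- - 1`; but `x > a`.
      have hend : (∀ z w, w ∈ f z → z.val ≠ x.val + 1) ∨
          (∀ z w, w ∈ f z → z.val + 1 ≠ x.val) := by
        by_contra! hcon
        obtain ⟨⟨z, w, hw, hz⟩, ⟨z', w', hw', hz'⟩⟩ := hcon
        have h1 := hf.1 hxy hw (pathGraph_adj.2 (by omega))
        have h2 := hf.1 hxy hw' (pathGraph_adj.2 (by omega))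
        rw [pathGraph_adj] at h1 h2
        have h3 := hd z w
        have h4 := hd z' w'
        have h5 : w ≠ w' := fun h => by
          have := f.inj hw (h ▸ hw')
          rw [Fin.ext_iff] at this
          omega
        rw [ne_eq, Fin.ext_iff] at h5
        by_cases hwa : w.val < a
        · have := h3 (Or.inr hwa) hw
          rw [Fin.ext_iff] at this
          omega
        · have := h4 (Or.inr (by omega)) hw'
          rw [Fin.ext_iff] at this
          omega
      by_cases hpre : ∀ x y, y ∈ f x → x.val + 1 ≠ a
      · exact mem_of_bring hM le_rfl (fun f hf hd _ x y hx hy hxy => fixed f hf hd x y hx hy hxy)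
          hf hd hpre hy hx.le hxy hend
      push Not at hpre
      obtain ⟨p, q, hpq, hp⟩ := hpre
      obtain rfl := hd p q (Or.inl (by omega)) hpq
      have hlow : ∀ u v : Fin n, v ∈ f u → v.val + 2 = a → u.val + 2 = a := by
        intro u v hm hv
        rw [hd u v (Or.inr (by omega)) hm] at hv
        exact hv
      -- The image of `a` would be adjacent to `a - 1`. But `a` is already the image of `x`, and `a
      -- - 2` can only come from itself.
      have hna : ∀ u v : Fin n, v ∈ f u → u.val ≠ a := by
        intro u v hm hu
        have h1 := hf.1 hpq hm (pathGraph_adj.2 (by omega))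
        rw [pathGraph_adj] at h1
        have h2 := hlow u v hm
        have h3 : v ≠ y := fun h => by
          have := f.inj hm (h ▸ hxy)
          rw [Fin.ext_iff] at this
          omega
        rw [ne_eq, Fin.ext_iff] at h3
        omega
      -- The adjacent vertices `a - 1` and `a` have the nonadjacent preimages `a - 1` and `x`, so
      -- the inverse of `f` is not a partial endomorphism.
      have hβ : ∀ i : Fin n, 0 < i.val → pathBeta i ∈ M := by
        refine hf.2.resolve_left fun hsymm => ?_
        have h1 := hsymm ((PEquiv.mem_iff_mem f).2 hpq) ((PEquiv.mem_iff_mem f).2 hxy)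
          (pathGraph_adj.2 (by omega))
        rw [pathGraph_adj] at h1
        omega
      refine mem_of_bring hM (Nat.le_succ a) ?_ hf hd
        (fun u v hm hu => hna u v hm (by omega)) hy hx hxy hend
      have hpos : 0 < y.val := by omega
      clear hd hf hxy hend hna hlow hpq hx x f
      intro f hf hd hna x u hx hu hxy
      obtain rfl : u = y := Fin.ext (by omega)
      -- Now `x = a + 1` and `a` is outside the domain, so β_a loses nothing; the second factor
      -- fixes `a`.
      have hfac : f = pathBeta u * ((pathBeta u).symm * f) := by
        refine PEquiv.ext_mem fun v w => ?_
        simp only [PEquiv.mem_mul_iff]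
        constructor
        · intro hm
          have := hna v w hm
          rcases lt_or_ge v.val u.val with hv | hv
          · have h : v ∈ pathBeta u v := mem_pathBeta.2 (Or.inl ⟨hv, rfl⟩)
            exact ⟨v, h, v, (PEquiv.mem_iff_mem _).2 h, hm⟩
          · have h : (⟨v.val - 1, by omega⟩ : Fin n) ∈ pathBeta u v :=
              mem_pathBeta.2 (Or.inr ⟨by omega, by simp only; omega⟩)
            exact ⟨_, h, v, (PEquiv.mem_iff_mem _).2 h, hm⟩
        · rintro ⟨z, hz, t, ht, hv⟩
          rwa [(pathBeta u).inj hz ((PEquiv.mem_iff_mem _).1 ht)]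
      have hval : ∀ {v w : Fin n}, w ∈ f v → v = x → w = u := by
        rintro v w h rfl
        exact PEquiv.mem_unique h hxy
      rw [hfac]
      refine M.mul_mem (hβ u hpos) (fixed _ ⟨?_, Or.inr hβ⟩ ?_ u u hy hy ?_)
      -- The inverse of β_a breaks only the edge between `a - 1` and `a`, sending it to `a - 1` and
      -- `a + 1`; `f` sends these back to `a - 1` and `a`.
      · intro v w v' w' hv hw hvw
        obtain ⟨p, hp, hv⟩ := PEquiv.mem_mul_iff.1 hv
        obtain ⟨q, hq, hw⟩ := PEquiv.mem_mul_iff.1 hw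
        rw [PEquiv.mem_iff_mem, mem_pathBeta] at hp hq
        have h1 := hf.1 hv hw
        have h2 := hd p v'
        have h3 := hd q w'
        have h4 := hval hv
        have h5 := hval hw
        simp only [pathGraph_adj, Fin.ext_iff] at *
        by_cases hpq : p.val + 1 = q.val ∨ q.val + 1 = p.val
        · exact h1 hpq
        rcases hp with hp | hp <;> rcases hq with hq | hq
        · omega
        · have := h2 (by omega) hv
          omega
        · have := h3 (by omega) hw
          omega
        · omega
      · intro v w hvw hm
        obtain ⟨p, hp, hw⟩ := PEquiv.mem_mul_iff.1 hm
        rw [PEquiv.mem_iff_mem, mem_pathBeta] at hp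
        have h1 := hd p w
        rw [Fin.ext_iff] at *
        rcases hvw with hvw | hvw
        · have := h1 (by omega) hw
          omega
        · have := h1 (by omega) hw
          omega
      · exact PEquiv.mem_mul_iff.2 ⟨x, (PEquiv.mem_iff_mem _).2
          (mem_pathBeta.2 (Or.inr ⟨by omega, by omega⟩)), hxy⟩
    by_cases hex : ∃ x y : Fin n, y.val = a ∧ y ∈ f x
    · obtain ⟨x, y, hy, hxy⟩ := hex
      exact hit f hf hd x y hy hxy
    push Not at hex
    by_cases hdom : ∃ x y : Fin n, x.val = a ∧ y ∈ f x
    swap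
    · push Not at hdom
      refine ih (a + 1) f (by omega) hf fun x y hxy hm => hd x y ?_ hm
      have h1 := hex x y
      have h2 := hdom x y
      by_contra! hcon
      rcases (by omega : x.val = a ∨ y.val = a) with h | h
      · exact h2 h hm
      · exact h1 h hm
    obtain ⟨x, y, hx, hxy⟩ := hdom
    have hya : a < y.val := by
      have h1 := hex x y
      have h2 := hd x y
      by_contra! hcon
      rcases hcon.lt_or_eq with h | h
      · have := h2 (Or.inr h) hxy
        rw [Fin.ext_iff] at this
        omega
      · exact h1 h hxy
    have hpre : ∀ u v, v ∈ f u → v.val + 1 ≠ a := by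
      intro u v hm hv
      obtain rfl := hd u v (Or.inr (by omega)) hm
      have := hf.1 hm hxy (pathGraph_adj.2 (by omega))
      rw [pathGraph_adj] at this
      omega
    -- Here `a` is in the domain but not in the range. With `c` the least element of the range above
    -- `a`, ρ_c followed by ρ_a sends `c` to `n - 1` and then to `a`, and neither `c - 1` nor `a -
    -- 1` is in the range concerned.
    have hmin : ∃ c, a < c ∧ ∃ x y : Fin n, y.val = c ∧ y ∈ f x := ⟨_, hya, x, y, rfl, hxy⟩
    classical
    obtain ⟨hc, u, v, hv, huv⟩ := Nat.find_spec hmin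
    have hlt := fun {c} => Nat.find_min hmin (m := c)
    generalize Nat.find hmin = c at *
    have hc' : ∀ p q, q ∈ f p → q.val + 1 ≠ c := by
      intro p q hm hq
      refine hlt (by omega) ⟨?_, p, q, rfl, hm⟩
      have := hex p q
      by_contra! hcon
      exact this (by omega) hm
    rw [← mul_suffixReversal_cancel hc']
    refine M.mul_mem ?_ (hM _ (by omega))
    have hpre' : ∀ p q, q ∈ (f * suffixReversal n c) p → q.val + 1 ≠ a := by
      intro p q hm hq
      obtain ⟨z, hz, hq'⟩ := PEquiv.mem_mul_iff.1 hm
      rw [mem_suffixReversal] at hq'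
      exact hpre p z hz (by omega)
    rw [← mul_suffixReversal_cancel hpre']
    refine M.mul_mem ?_ (hM _ (by omega))
    refine hit _ ((hf.mul_suffixReversal c).mul_suffixReversal a)
      ((hd.mul_suffixReversal hc.le).mul_suffixReversal le_rfl) u ⟨a, by omega⟩ rfl ?_
    refine PEquiv.mem_mul_iff.2 ⟨⟨n - 1, by omega⟩, PEquiv.mem_mul_iff.2 ⟨v, huv, ?_⟩, ?_⟩
    · rw [mem_suffixReversal]
      exact Or.inr ⟨by omega, by simp only; omega⟩
    · rw [mem_suffixReversal]
      exact Or.inr ⟨by simp only; omega, by simp only; omega⟩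

/-! ### The sets 𝒜 and ℬ generate. -/

theorem mem_pathTau_mul {n : ℕ} {f : Fin n ≃. Fin n} {x y : Fin n} :
    y ∈ (pathTau n * f) x ↔ y ∈ f x.rev := by
  rw [PEquiv.mem_mul_iff]
  constructor
  · rintro ⟨z, hz, hy⟩
    rw [mem_pathTau] at hz
    rwa [show x.rev = z from Fin.ext (by rw [Fin.val_rev]; omega)]
  · exact fun h => ⟨_, mem_pathTau.2 (by rw [Fin.val_rev]; omega), h⟩

theorem mem_mul_pathTau {n : ℕ} {f : Fin n ≃. Fin n} {x y : Fin n} :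
    y ∈ (f * pathTau n) x ↔ y.rev ∈ f x := by
  rw [PEquiv.mem_mul_iff]
  constructor
  · rintro ⟨z, hz, hy⟩
    rw [mem_pathTau] at hy
    rwa [show y.rev = z from Fin.ext (by rw [Fin.val_rev]; omega)]
  · exact fun h => ⟨_, h, mem_pathTau.2 (by rw [Fin.val_rev]; omega)⟩

theorem mem_pathAlpha_mul_self {n : ℕ} {i x y : Fin n} :
    y ∈ (pathAlpha i * pathAlpha i) x ↔ y = x ∧ x ≠ i := by
  rw [PEquiv.mem_mul_iff]
  constructor
  · rintro ⟨z, hz, hy⟩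
    rw [mem_pathAlpha] at hz hy
    simp only [ne_eq, Fin.ext_iff]
    omega
  · rintro ⟨rfl, h⟩
    rw [ne_eq, Fin.ext_iff] at h
    obtain ⟨z, hz⟩ := exists_mem_suffixReversal (x := y) (s := i.val + 1) (by omega)
    rw [← suffixReversal_succ]
    exact ⟨z, hz, mem_suffixReversal_comm.1 hz⟩

theorem pathTau_mul_self (n : ℕ) : pathTau n * pathTau n = 1 :=
  PEquiv.ext_mem fun x y => by
    rw [mem_pathTau_mul, mem_pathTau, PEquiv.mem_one_iff, Fin.val_rev, Fin.ext_iff]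
    omega

theorem natCeil_half (n : ℕ) : ⌈(n : ℚ) / 2⌉₊ = (n + 1) / 2 := by
  rcases Nat.even_or_odd' n with ⟨k, rfl | rfl⟩
  · rw [show ((2 * k : ℕ) : ℚ) / 2 = (k : ℕ) by push_cast; ring, Nat.ceil_natCast]
    omega
  · rw [show (2 * k + 1 + 1) / 2 = k + 1 by omega, Nat.ceil_eq_iff (by omega)]
    push_cast
    constructor <;> linarith

/-- The number of maps `α_i` in the generating set `𝒜`. -/
def alphaCount (n : ℕ) : ℕ := if n = 3 then 2 else n - 2

theorem pathSetA_eq (n : ℕ) :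
    pathSetA n = {pathTau n} ∪ {f | ∃ i : Fin n, i.val + 1 ≤ alphaCount n ∧ f = pathAlpha i} := by
  unfold pathSetA alphaCount
  split_ifs <;> rfl

theorem pathTau_mem_pathSetA (n : ℕ) : pathTau n ∈ pathSetA n := by
  rw [pathSetA_eq]; exact Or.inl rfl

theorem pathAlpha_mem_pathSetA {n : ℕ} {i : Fin n} (h : i.val + 1 ≤ alphaCount n) :
    pathAlpha i ∈ pathSetA n := by
  rw [pathSetA_eq]; exact Or.inr ⟨i, h, rfl⟩

theorem suffixReversal_mem_closure {n : ℕ} (hn : 3 ≤ n) {s : ℕ} (hs : s ≤ n) :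
    suffixReversal n s ∈ Submonoid.closure (pathSetA n) := by
  have hτ := Submonoid.subset_closure (pathTau_mem_pathSetA n)
  have hα : ∀ i : Fin n, i.val + 1 ≤ alphaCount n →
      pathAlpha i ∈ Submonoid.closure (pathSetA n) := fun i hi =>
    Submonoid.subset_closure (pathAlpha_mem_pathSetA hi)
  rcases s with _ | s
  · rwa [suffixReversal_zero]
  let i : Fin n := ⟨s, hs⟩
  rw [show s + 1 = i.val + 1 from rfl, suffixReversal_succ]
  have hi : i.val = s := rfl
  clear_value i
  unfold alphaCount at hα
  by_cases h : i.val + 1 ≤ if n = 3 then 2 else n - 2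
  · exact hα i h
  have hlt := i.isLt
  -- At most one vertex lies above `i`, so α_i is a partial identity. For `n = 3` the middle vertex
  -- is its own mirror image and α_2 must be kept, whence the exceptional value of `alphaCount`.
  have hconj : pathAlpha i = pathTau n * (pathAlpha i.rev * pathAlpha i.rev) * pathTau n := by
    refine PEquiv.ext_mem fun x y => ?_
    rw [mem_mul_pathTau, mem_pathTau_mul, mem_pathAlpha_mul_self, mem_pathAlpha, ne_eq,
      Fin.rev_inj, Fin.rev_inj, Fin.ext_iff, Fin.ext_iff]
    split_ifs at h <;> omega
  have hrev := hα i.rev (by rw [Fin.val_rev]; split_ifs at h ⊢ <;> omega)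
  rw [hconj]
  exact mul_mem (mul_mem hτ (mul_mem hrev hrev)) hτ

theorem closure_pathSetA {n : ℕ} (hn : 3 ≤ n) :
    Submonoid.closure (pathSetA n) = PAut (pathGraph n) := by
  refine le_antisymm (Submonoid.closure_le.2 ?_) fun f hf => ?_
  · rw [pathSetA_eq]
    rintro f (rfl | ⟨i, -, rfl⟩)
    · exact pathTau_mem_PAut n
    · exact pathAlpha_mem_PAut i
  · exact mem_of_admissible (fun s hs => suffixReversal_mem_closure hn hs) n 0 f (by omega)
      ⟨hf.1, Or.inl hf.2⟩ fun x y h => by omega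

theorem pathBeta_mem_closure {n : ℕ} (hn : 3 ≤ n) {i : Fin n} (hi : 0 < i.val) :
    pathBeta i ∈ Submonoid.closure (pathSetB n) := by
  have hA : Submonoid.closure (pathSetA n) ≤ Submonoid.closure (pathSetB n) :=
    Submonoid.closure_mono Set.subset_union_left
  have hτ := hA (Submonoid.subset_closure (pathTau_mem_pathSetA n))
  have hα : ∀ i : Fin n, pathAlpha i ∈ Submonoid.closure (pathSetB n) := fun i => by
    rw [← suffixReversal_succ]
    exact hA (suffixReversal_mem_closure hn i.isLt)
  have hβ : ∀ i : Fin n, 0 < i.val → i.val + 1 ≤ (n + 1) / 2 →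
      pathBeta i ∈ Submonoid.closure (pathSetB n) := fun i hi hi' =>
    Submonoid.subset_closure (Or.inr ⟨i, by omega, by rwa [natCeil_half], rfl⟩)
  by_cases h : i.val + 1 ≤ (n + 1) / 2
  · exact hβ i hi h
  by_cases hlast : i.val + 1 = n
  · convert hα i using 1
    refine PEquiv.ext_mem fun x y => ?_
    rw [mem_pathBeta, mem_pathAlpha]
    omega
  have hrev := hβ i.rev (by rw [Fin.val_rev]; omega) (by rw [Fin.val_rev]; omega)
  -- Conjugating the mirror β by τ gives the map that fixes everything above `i` and raises
  -- everything below by one; α_1 followed by τ lowers all values by one.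
  have hconj : pathBeta i =
      pathTau n * pathBeta i.rev * pathTau n * pathAlpha ⟨0, by omega⟩ * pathTau n := by
    refine PEquiv.ext_mem fun x y => ?_
    simp only [mem_mul_pathTau, PEquiv.mem_mul_iff (g := pathAlpha _), mem_pathTau_mul,
      mem_pathBeta, mem_pathAlpha, Fin.val_rev]
    constructor
    · rintro (hx | hx)
      · exact ⟨⟨x.val + 1, by omega⟩, by simp only; omega⟩
      · exact ⟨⟨x.val, by omega⟩, by simp only [and_true]; omega⟩
    · rintro ⟨z, hz⟩
      omega
  rw [hconj]
  exact mul_mem (mul_mem (mul_mem (mul_mem hτ hrev) hτ) (hα _)) hτ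

theorem closure_pathSetB {n : ℕ} (hn : 3 ≤ n) :
    Submonoid.closure (pathSetB n) = IEnd (pathGraph n) := by
  have hA : Submonoid.closure (pathSetA n) ≤ Submonoid.closure (pathSetB n) :=
    Submonoid.closure_mono Set.subset_union_left
  refine le_antisymm (Submonoid.closure_le.2 ?_) fun f hf => ?_
  · rintro f (hf | ⟨i, -, -, rfl⟩)
    · exact PAut_le_IEnd _ (closure_pathSetA hn ▸ Submonoid.subset_closure hf)
    · exact isPartialEnd_pathBeta i
  · exact mem_of_admissible (fun s hs => hA (suffixReversal_mem_closure hn hs)) n 0 f (by omega)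
      ⟨hf, Or.inr fun i hi => pathBeta_mem_closure hn hi⟩ fun x y h => by omega

/-! ### Total maps and maps of corank one. -/

/-- The partial map `f` is defined everywhere. -/
def PEquiv.IsTotal {V : Type*} (f : V ≃. V) : Prop := ∀ x, ∃ y, y ∈ f x

/-- The partial map `f` is undefined at `k` only. -/
def PEquiv.OmitsOnly {V : Type*} (f : V ≃. V) (k : V) : Prop := ∀ x, (∃ y, y ∈ f x) ↔ x ≠ k

theorem PEquiv.isTotal_or_omitsOnly {V : Type*} {f : V ≃. V} {k : V}
    (h : ∀ x, x ≠ k → ∃ y, y ∈ f x) : f.IsTotal ∨ f.OmitsOnly k := by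
  by_cases hk : ∃ y, y ∈ f k
  · left
    intro x
    by_cases hx : x = k
    · rwa [hx]
    · exact h x hx
  · right
    intro x
    refine ⟨?_, h x⟩
    rintro hx rfl
    exact hk hx

theorem PEquiv.card_range_eq_card_dom {V : Type*} [Fintype V] (f : V ≃. V)
    [DecidablePred fun x => ∃ y, y ∈ f x] [DecidablePred fun y => ∃ x, y ∈ f x] :
    (Finset.univ.filter fun x => ∃ y, y ∈ f x).card =
      (Finset.univ.filter fun y => ∃ x, y ∈ f x).card := by
  classical
  refine Finset.card_bij
    (fun x hx => ((Finset.mem_filter.1 hx).2).choose) ?_ ?_ ?_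
  · intro x hx
    exact Finset.mem_filter.2 ⟨Finset.mem_univ _, x, ((Finset.mem_filter.1 hx).2).choose_spec⟩
  · intro x hx x' hx' h
    exact f.inj ((Finset.mem_filter.1 hx).2).choose_spec
      (h ▸ ((Finset.mem_filter.1 hx').2).choose_spec)
  · intro y hy
    obtain ⟨x, hx⟩ := (Finset.mem_filter.1 hy).2
    exact ⟨x, Finset.mem_filter.2 ⟨Finset.mem_univ _, y, hx⟩,
      PEquiv.mem_unique (Exists.choose_spec (⟨y, hx⟩ : ∃ y, y ∈ f x)) hx⟩

theorem PEquiv.IsTotal.surjective {V : Type*} [Finite V] {f : V ≃. V} (h : f.IsTotal) (y : V) :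
    ∃ x, y ∈ f x := by
  classical
  have := Fintype.ofFinite V
  have hc := f.card_range_eq_card_dom
  rw [Finset.filter_true_of_mem (fun x _ => h x), eq_comm, Finset.card_univ,
    Finset.card_eq_iff_eq_univ] at hc
  have hy := Finset.mem_univ y
  rw [← hc, Finset.mem_filter] at hy
  exact hy.2

theorem PEquiv.OmitsOnly.exists_range {V : Type*} [Finite V] {f : V ≃. V} {k : V}
    (h : f.OmitsOnly k) : ∃ l, ∀ y, (∃ x, y ∈ f x) ↔ y ≠ l := by
  classical
  have := Fintype.ofFinite V
  have hc := f.card_range_eq_card_dom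
  have hd : (Finset.univ.filter fun x => ∃ y, y ∈ f x) = {k}ᶜ := by
    ext x
    simpa using h x
  rw [hd, Finset.card_compl, Finset.card_singleton] at hc
  have hpos : 0 < Fintype.card V := Fintype.card_pos_iff.2 ⟨k⟩
  have h1 : (Finset.univ.filter fun y => ∃ x, y ∈ f x)ᶜ.card = 1 := by
    rw [Finset.card_compl, ← hc]
    omega
  obtain ⟨l, hl⟩ := Finset.card_eq_one.1 h1
  refine ⟨l, fun y => ?_⟩
  have := Finset.ext_iff.1 hl y
  simp only [Finset.mem_compl, Finset.mem_filter, Finset.mem_univ, true_and,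
    Finset.mem_singleton] at this
  rw [ne_eq, ← this, not_not]

theorem PEquiv.exists_mem_of_mul {V : Type*} {g f : V ≃. V} {x : V} (h : ∃ y, y ∈ (g * f) x) :
    ∃ y, y ∈ g x := by
  obtain ⟨y, h⟩ := h
  obtain ⟨z, hz, -⟩ := PEquiv.mem_mul_iff.1 h
  exact ⟨z, hz⟩

theorem PEquiv.IsTotal.of_mul_left {V : Type*} {g f : V ≃. V} (h : (g * f).IsTotal) :
    g.IsTotal := fun x => exists_mem_of_mul (h x)

theorem PEquiv.IsTotal.of_mul_right {V : Type*} [Finite V] {g f : V ≃. V}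
    (h : (g * f).IsTotal) : f.IsTotal := by
  intro y
  obtain ⟨x, hx⟩ := h.of_mul_left.surjective y
  obtain ⟨w, hw⟩ := h x
  obtain ⟨z, hz, hw⟩ := PEquiv.mem_mul_iff.1 hw
  exact ⟨w, PEquiv.mem_unique hx hz ▸ hw⟩

/-- If `g` is not total, it already accounts for the one missing vertex, so `f` is defined on the
whole range of `g`. -/
theorem PEquiv.isTotal_or_of_mul {V : Type*} [Finite V] {g f : V ≃. V} {k : V}
    (h : ∀ x, x ≠ k → ∃ y, y ∈ (g * f) x) :
    g.IsTotal ∨ (g.OmitsOnly k ∧ ∃ l, (∀ y, (∃ x, y ∈ g x) ↔ y ≠ l) ∧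
      ∀ y, y ≠ l → ∃ z, z ∈ f y) := by
  refine (isTotal_or_omitsOnly fun x hx => exists_mem_of_mul (h x hx)).imp_right fun hg => ?_
  obtain ⟨l, hl⟩ := hg.exists_range
  refine ⟨hg, l, hl, fun y hy => ?_⟩
  obtain ⟨x, hx⟩ := (hl y).2 hy
  obtain ⟨w, hw⟩ := h x ((hg x).1 ⟨y, hx⟩)
  obtain ⟨z, hz, hw⟩ := PEquiv.mem_mul_iff.1 hw
  exact ⟨w, PEquiv.mem_unique hx hz ▸ hw⟩

theorem not_isTotal_pathAlpha {n : ℕ} (i : Fin n) : ¬ (pathAlpha i).IsTotal := by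
  intro h
  obtain ⟨y, hy⟩ := h i
  rw [mem_pathAlpha] at hy
  omega

theorem not_isTotal_pathBeta {n : ℕ} (i : Fin n) : ¬ (pathBeta i).IsTotal := by
  intro h
  obtain ⟨y, hy⟩ := h i
  rw [mem_pathBeta] at hy
  omega

/-- Factors of a total product are total, and τ is the only total element of ℬ. -/
theorem eq_one_or_eq_pathTau {n : ℕ} (hn : 3 ≤ n) {f : Fin n ≃. Fin n}
    (hf : f ∈ IEnd (pathGraph n)) (ht : f.IsTotal) : f = 1 ∨ f = pathTau n := by
  rw [← closure_pathSetB hn] at hf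
  induction hf using Submonoid.closure_induction_left with
  | one => exact Or.inl rfl
  | mul_left g hg f hf ih =>
    have hgt := ht.of_mul_left
    have hgτ : g = pathTau n := by
      rcases hg with hg | ⟨i, -, -, rfl⟩
      · rw [pathSetA_eq] at hg
        rcases hg with rfl | ⟨i, -, rfl⟩
        · rfl
        · exact absurd hgt (not_isTotal_pathAlpha i)
      · exact absurd hgt (not_isTotal_pathBeta i)
    rcases ih ht.of_mul_right with rfl | rfl
    · exact Or.inr (by rw [hgτ, mul_one])
    · exact Or.inl (by rw [hgτ, pathTau_mul_self])

theorem mem_PAut_of_isTotal {n : ℕ} (hn : 3 ≤ n) {f : Fin n ≃. Fin n}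
    (hf : f ∈ IEnd (pathGraph n)) (ht : f.IsTotal) : f ∈ PAut (pathGraph n) := by
  rcases eq_one_or_eq_pathTau hn hf ht with rfl | rfl
  · exact one_mem _
  · exact pathTau_mem_PAut n

/-- An edge in the range of `g` is pushed forward by `f`, then pulled back by the inverse of `g *
f`. -/
theorem left_mem_PAut_of_mul {V : Type*} {G : SimpleGraph V} {g f : V ≃. V}
    (hg : g ∈ IEnd G) (hf : f ∈ IEnd G) (h : g * f ∈ PAut G)
    (hdom : ∀ x y, y ∈ g x → ∃ z, z ∈ f y) : g ∈ PAut G := by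
  refine ⟨hg, fun u' v' u v hu hv huv => ?_⟩
  rw [PEquiv.mem_iff_mem] at hu hv
  obtain ⟨p, hp⟩ := hdom _ _ hu
  obtain ⟨q, hq⟩ := hdom _ _ hv
  exact h.2 ((PEquiv.mem_iff_mem _).2 (PEquiv.mem_mul_iff.2 ⟨_, hu, hp⟩))
    ((PEquiv.mem_iff_mem _).2 (PEquiv.mem_mul_iff.2 ⟨_, hv, hq⟩)) (hf hp hq huv)

theorem right_mem_PAut_of_mul {V : Type*} {G : SimpleGraph V} {g f : V ≃. V}
    (hg : g ∈ IEnd G) (hf : f ∈ IEnd G) (h : g * f ∈ PAut G)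
    (hdom : ∀ y z, z ∈ f y → ∃ x, y ∈ g x) : f ∈ PAut G := by
  refine ⟨hf, fun u' v' u v hu hv huv => ?_⟩
  rw [PEquiv.mem_iff_mem] at hu hv
  obtain ⟨p, hp⟩ := hdom _ _ hu
  obtain ⟨q, hq⟩ := hdom _ _ hv
  exact hg hp hq (h.2 ((PEquiv.mem_iff_mem _).2 (PEquiv.mem_mul_iff.2 ⟨_, hp, hu⟩))
    ((PEquiv.mem_iff_mem _).2 (PEquiv.mem_mul_iff.2 ⟨_, hq, hv⟩)) huv)

/-- With at most one vertex missing, the range of `g` and the domain of `f` fit together well enough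
that both factors of a product in `PAut` lie in `PAut`. All elements of 𝒜 are of this kind. -/
theorem mem_closure_inter_PAut {n : ℕ} (hn : 3 ≤ n) {S : Set (Fin n ≃. Fin n)}
    (hS : Submonoid.closure S = IEnd (pathGraph n)) {f : Fin n ≃. Fin n}
    (hf : f ∈ PAut (pathGraph n)) {k : Fin n} (hk : ∀ x, x ≠ k → ∃ y, y ∈ f x) :
    f ∈ Submonoid.closure (S ∩ (PAut (pathGraph n) : Set (Fin n ≃. Fin n))) := by
  have hfS : f ∈ Submonoid.closure S := hS ▸ hf.1
  induction hfS using Submonoid.closure_induction_left generalizing k with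
  | one => exact one_mem _
  | mul_left g hg f hfS ih =>
    have hgE : g ∈ IEnd (pathGraph n) := hS ▸ Submonoid.subset_closure hg
    have hfE : f ∈ IEnd (pathGraph n) := hS ▸ hfS
    have key : g ∈ PAut (pathGraph n) ∧ f ∈ PAut (pathGraph n) ∧
        ∃ l, ∀ x, x ≠ l → ∃ y, y ∈ f x := by
      rcases PEquiv.isTotal_or_of_mul hk with hgt | ⟨-, l, hl, hfl⟩
      · refine ⟨mem_PAut_of_isTotal hn hgE hgt,
          right_mem_PAut_of_mul hgE hfE hf fun y z _ => hgt.surjective y, ?_⟩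
        obtain ⟨l, hl⟩ := hgt k
        refine ⟨l, fun y hy => ?_⟩
        obtain ⟨x, hx⟩ := hgt.surjective y
        obtain ⟨w, hw⟩ := hk x (by rintro rfl; exact hy (PEquiv.mem_unique hx hl))
        obtain ⟨z, hz, hw⟩ := PEquiv.mem_mul_iff.1 hw
        exact ⟨w, PEquiv.mem_unique hx hz ▸ hw⟩
      · refine ⟨left_mem_PAut_of_mul hgE hfE hf fun x y hxy => hfl y ((hl y).1 ⟨x, hxy⟩), ?_,
          l, hfl⟩
        rcases PEquiv.isTotal_or_omitsOnly hfl with hft | hfo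
        · exact mem_PAut_of_isTotal hn hfE hft
        · exact right_mem_PAut_of_mul hgE hfE hf fun y z hz => (hl y).2 ((hfo y).1 ⟨z, hz⟩)
    obtain ⟨hgP, hfP, l, hl⟩ := key
    exact mul_mem (Submonoid.subset_closure ⟨hg, hgP⟩) (ih hfP hl)

theorem isTotal_pathTau (n : ℕ) : (pathTau n).IsTotal := fun x =>
  ⟨x.rev, mem_pathTau.2 (by rw [Fin.val_rev]; omega)⟩

theorem omitsOnly_pathAlpha {n : ℕ} (i : Fin n) : (pathAlpha i).OmitsOnly i := by
  intro x
  rw [← suffixReversal_succ]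
  constructor
  · rintro ⟨y, hy⟩ rfl
    rw [mem_suffixReversal] at hy
    omega
  · exact fun h => exists_mem_suffixReversal fun h' => h (Fin.ext (by omega))

theorem closure_inter_PAut {n : ℕ} (hn : 3 ≤ n) {S : Set (Fin n ≃. Fin n)}
    (hS : Submonoid.closure S = IEnd (pathGraph n)) :
    Submonoid.closure (S ∩ (PAut (pathGraph n) : Set (Fin n ≃. Fin n))) =
      PAut (pathGraph n) := by
  refine le_antisymm (Submonoid.closure_le.2 Set.inter_subset_right) ?_
  rw [← closure_pathSetA hn, Submonoid.closure_le, closure_pathSetA hn, pathSetA_eq]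
  rintro f (rfl | ⟨i, -, rfl⟩)
  · exact mem_closure_inter_PAut hn hS (pathTau_mem_PAut n) (k := ⟨0, by omega⟩)
      fun x _ => isTotal_pathTau n x
  · exact mem_closure_inter_PAut hn hS (pathAlpha_mem_PAut i) (k := i)
      fun x hx => (omitsOnly_pathAlpha i x).2 hx

theorem exists_isTotal_mem {n : ℕ} (hn : 3 ≤ n) {S : Set (Fin n ≃. Fin n)}
    (hS : pathTau n ∈ Submonoid.closure S) : ∃ g ∈ S, g.IsTotal := by
  by_contra! hcon
  have key : ∀ f ∈ Submonoid.closure S, f.IsTotal → f = 1 := by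
    intro f hf ht
    induction hf using Submonoid.closure_induction_left with
    | one => rfl
    | mul_left g hg f hf ih => exact absurd ht.of_mul_left (hcon g hg)
  have h := key _ hS (isTotal_pathTau n)
  have h1 : (⟨0, by omega⟩ : Fin n) ∈ pathTau n ⟨0, by omega⟩ := by
    rw [h, PEquiv.mem_one_iff]
  rw [mem_pathTau] at h1
  simp only at h1
  omega

theorem PEquiv.OmitsOnly.not_isTotal {V : Type*} {f : V ≃. V} {k : V} (h : f.OmitsOnly k) :
    ¬ f.IsTotal := fun ht => (h k).1 (ht k) rfl

theorem PEquiv.OmitsOnly.eq {V : Type*} {f : V ≃. V} {k l : V} (h : f.OmitsOnly k)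
    (h' : ∀ x, x ≠ l → ∃ y, y ∈ f x) : l = k := by
  by_contra hne
  exact (h k).1 (h' k (Ne.symm hne)) rfl

theorem omitsOnly_pathTau_mul {n : ℕ} {f : Fin n ≃. Fin n} {k : Fin n} :
    (pathTau n * f).OmitsOnly k ↔ f.OmitsOnly k.rev := by
  unfold PEquiv.OmitsOnly
  simp only [mem_pathTau_mul]
  constructor
  · intro h x
    have := h x.rev
    rwa [Fin.rev_rev, ne_eq, Fin.rev_eq_iff] at this
  · intro h x
    rw [h x.rev, ne_eq, ne_eq, Fin.rev_inj]

/-! ### The missing vertex up to reflection. -/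

/-- A partial automorphism defined off `d` maps the two sides of `d` to the sides of `d`,
or to the sides of its mirror image. -/
theorem sides_of_mem_PAut {n : ℕ} (hn : 3 ≤ n) {f : Fin n ≃. Fin n}
    (hf : f ∈ PAut (pathGraph n)) {d : Fin n} (hd : ∀ x, x ≠ d → ∃ y, y ∈ f x) :
    (∀ x y, y ∈ f x → (x < d → y < d) ∧ (d < x → d < y)) ∨
      (∀ x y, y ∈ f x → (x < d → d.rev < y) ∧ (d < x → y < d.rev)) := by
  rw [← closure_pathSetA hn] at hf
  induction hf using Submonoid.closure_induction_left generalizing d with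
  | one =>
    left
    intro x y hxy
    rw [PEquiv.mem_one_iff] at hxy
    subst hxy
    exact ⟨id, id⟩
  | mul_left g hg f hf ih =>
    rw [pathSetA_eq] at hg
    rcases hg with rfl | ⟨i, -, rfl⟩
    · simp only [mem_pathTau_mul] at hd ⊢
      have h := ih (d := d.rev) fun x hx => by
        have := hd x.rev (by rwa [ne_eq, Fin.rev_eq_iff])
        rwa [Fin.rev_rev] at this
      rw [Fin.rev_rev] at h
      rcases h with h | h
      · refine Or.inr fun x y hxy => ?_
        have := h _ _ hxy
        rw [Fin.rev_lt_rev, Fin.rev_lt_rev] at this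
        exact this.symm
      · refine Or.inl fun x y hxy => ?_
        have := h _ _ hxy
        rw [Fin.rev_lt_rev, Fin.rev_lt_rev] at this
        exact this.symm
    · obtain rfl := (omitsOnly_pathAlpha i).eq fun x hx => PEquiv.exists_mem_of_mul (hd x hx)
      have hfd : ∀ x, x ≠ d → ∃ y, y ∈ f x := by
        intro x hx
        obtain ⟨z, hz⟩ := (omitsOnly_pathAlpha d x).2 hx
        have hz' : x ∈ pathAlpha d z := by
          rw [mem_pathAlpha] at hz ⊢
          omega
        obtain ⟨w, hw⟩ := hd z ((omitsOnly_pathAlpha d z).1 ⟨x, hz'⟩)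
        obtain ⟨u, hu, hw⟩ := PEquiv.mem_mul_iff.1 hw
        exact ⟨w, PEquiv.mem_unique hz' hu ▸ hw⟩
      refine (ih hfd).imp ?_ ?_
      · intro h x y hxy
        obtain ⟨z, hz, hy⟩ := PEquiv.mem_mul_iff.1 hxy
        rw [mem_pathAlpha] at hz
        have := h z y hy
        simp only [Fin.lt_def] at *
        omega
      · intro h x y hxy
        obtain ⟨z, hz, hy⟩ := PEquiv.mem_mul_iff.1 hxy
        rw [mem_pathAlpha] at hz
        have := h z y hy
        simp only [Fin.lt_def] at *
        omega

/-- Since sides go to sides, a preimage of `k` (or of `k.rev`) could lie on neither side of `k`. -/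
theorem eq_or_eq_rev_of_range {n : ℕ} (hn : 3 ≤ n) {f : Fin n ≃. Fin n}
    (hf : f ∈ PAut (pathGraph n)) {k l : Fin n} (hk : f.OmitsOnly k)
    (hl : ∀ y, (∃ x, y ∈ f x) ↔ y ≠ l) : l = k ∨ l = k.rev := by
  have key : ∀ m : Fin n, (∀ x, m ∈ f x → x = k) → l = m := by
    intro m h
    by_contra hne
    obtain ⟨x, hx⟩ := (hl m).2 (Ne.symm hne)
    exact (hk x).1 ⟨m, hx⟩ (h x hx)
  refine (sides_of_mem_PAut hn hf fun x => (hk x).2).imp (fun h => key _ fun x hx => ?_)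
    fun h => key _ fun x hx => ?_
  · have := h _ _ hx
    simp only [lt_irrefl, imp_false, not_lt] at this
    exact le_antisymm this.2 this.1
  · have := h _ _ hx
    simp only [lt_irrefl, imp_false, not_lt] at this
    exact le_antisymm this.2 this.1

theorem exists_omitsOnly_mem {n : ℕ} (hn : 3 ≤ n) {S : Set (Fin n ≃. Fin n)}
    (hS : S ⊆ IEnd (pathGraph n)) {f : Fin n ≃. Fin n} (hf : f ∈ Submonoid.closure S)
    {k : Fin n} (hk : f.OmitsOnly k) : ∃ g ∈ S, g.OmitsOnly k ∨ g.OmitsOnly k.rev := by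
  induction hf using Submonoid.closure_induction_left generalizing k with
  | one => exact absurd (fun x => ⟨x, PEquiv.mem_one_iff.2 rfl⟩) hk.not_isTotal
  | mul_left g hg f hf ih =>
    rcases PEquiv.isTotal_or_of_mul fun x => (hk x).2 with ht | ⟨ho, -⟩
    · rcases eq_one_or_eq_pathTau hn (hS hg) ht with rfl | rfl
      · rw [one_mul] at hk
        exact ih hk
      · have := ih (omitsOnly_pathTau_mul.1 hk)
        simpa only [Fin.rev_rev, or_comm] using this
    · exact ⟨g, hg, Or.inl ho⟩

/-- Factors in `PAut` are stripped from the left; each keeps the missing vertex in its mirror class,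
until the first factor outside `PAut` appears. -/
theorem exists_omitsOnly_notMem_PAut {n : ℕ} (hn : 3 ≤ n) {S : Set (Fin n ≃. Fin n)}
    (hS : S ⊆ IEnd (pathGraph n)) {f : Fin n ≃. Fin n} (hf : f ∈ Submonoid.closure S)
    (hfP : f ∉ PAut (pathGraph n)) {k : Fin n} (hk : f.OmitsOnly k) :
    ∃ g ∈ S, g ∉ PAut (pathGraph n) ∧ (g.OmitsOnly k ∨ g.OmitsOnly k.rev) := by
  induction hf using Submonoid.closure_induction_left generalizing k with
  | one => exact absurd (one_mem _) hfP
  | mul_left g hg f hf ih =>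
    have hfE : f ∈ IEnd (pathGraph n) := Submonoid.closure_le.2 hS hf
    by_cases hgP : g ∈ PAut (pathGraph n)
    swap
    · rcases PEquiv.isTotal_or_of_mul fun x => (hk x).2 with ht | ⟨ho, -⟩
      · exact absurd (mem_PAut_of_isTotal hn (hS hg) ht) hgP
      · exact ⟨g, hg, hgP, Or.inl ho⟩
    have hfP' : f ∉ PAut (pathGraph n) := fun h => hfP (mul_mem hgP h)
    rcases PEquiv.isTotal_or_of_mul fun x => (hk x).2 with ht | ⟨ho, l, hl, hfl⟩
    · rcases eq_one_or_eq_pathTau hn (hS hg) ht with rfl | rfl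
      · rw [one_mul] at hk
        exact ih hfP' hk
      · have := ih hfP' (omitsOnly_pathTau_mul.1 hk)
        simpa only [Fin.rev_rev, or_comm] using this
    · rcases PEquiv.isTotal_or_omitsOnly hfl with ht | hfo
      · exact absurd (mem_PAut_of_isTotal hn hfE ht) hfP'
      · have := ih hfP' hfo
        rcases eq_or_eq_rev_of_range hn hgP ho hl with rfl | rfl
        · exact this
        · simpa only [Fin.rev_rev, or_comm] using this

theorem omitsOnly_pathBeta {n : ℕ} (i : Fin n) : (pathBeta i).OmitsOnly i := by
  intro x
  constructor
  · rintro ⟨y, hy⟩ rfl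
    rw [mem_pathBeta] at hy
    omega
  · intro h
    rcases lt_or_gt_of_ne h with h | h
    · exact ⟨x, mem_pathBeta.2 (Or.inl ⟨h, rfl⟩)⟩
    · rw [Fin.lt_def] at h
      exact ⟨⟨x.val - 1, by omega⟩, mem_pathBeta.2 (Or.inr ⟨h, by simp only; omega⟩)⟩

theorem pathBeta_notMem_PAut {n : ℕ} {i : Fin n} (hi : 0 < i.val) (hi' : i.val + 1 < n) :
    pathBeta i ∉ PAut (pathGraph n) := by
  intro h
  have h1 : (⟨i.val - 1, by omega⟩ : Fin n) ∈ pathBeta i ⟨i.val - 1, by omega⟩ :=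
    mem_pathBeta.2 (Or.inl ⟨by simp only; omega, rfl⟩)
  have h2 : i ∈ pathBeta i ⟨i.val + 1, hi'⟩ :=
    mem_pathBeta.2 (Or.inr ⟨by simp only; omega, rfl⟩)
  have := h.2 ((PEquiv.mem_iff_mem _).2 h1) ((PEquiv.mem_iff_mem _).2 h2)
    (pathGraph_adj.2 (by simp only; omega))
  rw [pathGraph_adj] at this
  simp only at this
  omega

/-! ### The four-group of flips off a vertex. -/

/-- The map `f` is an involution of the complement of `k`. -/
def IsInvolutionOff {V : Type*} (k : V) (f : V ≃. V) : Prop :=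
  f.OmitsOnly k ∧ ∀ x y, y ∈ f x → x ∈ f y

theorem IsInvolutionOff.range {V : Type*} {k : V} {f : V ≃. V} (h : IsInvolutionOff k f) (y : V) :
    (∃ x, y ∈ f x) ↔ y ≠ k := by
  rw [← h.1 y]
  exact exists_congr fun x => ⟨h.2 x y, h.2 y x⟩

section

variable {n : ℕ} {k : Fin n} {e : Fin n ≃. Fin n}

theorem IsInvolutionOff.mul_self (h : IsInvolutionOff k e) :
    e * e = pathAlpha k * pathAlpha k := by
  refine PEquiv.ext_mem fun x y => ?_
  rw [mem_pathAlpha_mul_self, PEquiv.mem_mul_iff]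
  constructor
  · rintro ⟨z, hz, hy⟩
    exact ⟨PEquiv.mem_unique hy (h.2 _ _ hz), (h.1 x).1 ⟨z, hz⟩⟩
  · rintro ⟨rfl, hy⟩
    obtain ⟨z, hz⟩ := (h.1 y).2 hy
    exact ⟨z, hz, h.2 _ _ hz⟩

theorem IsInvolutionOff.idem_mul (h : IsInvolutionOff k e) :
    pathAlpha k * pathAlpha k * e = e := by
  refine PEquiv.ext_mem fun x y => ?_
  rw [PEquiv.mem_mul_iff]
  simp only [mem_pathAlpha_mul_self]
  constructor
  · rintro ⟨z, ⟨rfl, -⟩, hy⟩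
    exact hy
  · exact fun hy => ⟨x, ⟨rfl, (h.1 x).1 ⟨y, hy⟩⟩, hy⟩

theorem IsInvolutionOff.mul_idem (h : IsInvolutionOff k e) :
    e * (pathAlpha k * pathAlpha k) = e := by
  rw [← h.mul_self, ← mul_assoc, h.mul_self, h.idem_mul]

theorem isInvolutionOff_idem : IsInvolutionOff k (pathAlpha k * pathAlpha k) := by
  constructor
  · intro x
    simp only [mem_pathAlpha_mul_self, exists_eq_left]
  · intro x y h
    rw [mem_pathAlpha_mul_self] at *
    exact ⟨h.1.symm, h.1 ▸ h.2⟩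

theorem isInvolutionOff_pathAlpha : IsInvolutionOff k (pathAlpha k) :=
  ⟨omitsOnly_pathAlpha k, fun x y h => by rw [mem_pathAlpha] at *; omega⟩

variable (k) in
/-- The map that is undefined at `k`, fixes every `x > k` and reverses the interval below `k`. -/
def prefixReversal : Fin n ≃. Fin n := pathTau n * pathAlpha k.rev * pathTau n

theorem mem_prefixReversal {x y : Fin n} : y ∈ prefixReversal k x ↔
    (x.val < k.val ∧ x.val + y.val + 1 = k.val) ∨ (k.val < x.val ∧ y.val = x.val) := by
  rw [prefixReversal, mem_mul_pathTau, mem_pathTau_mul, mem_pathAlpha]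
  simp only [Fin.val_rev]
  omega

theorem isInvolutionOff_prefixReversal : IsInvolutionOff k (prefixReversal k) := by
  refine ⟨fun x => ?_, fun x y h => by rw [mem_prefixReversal] at *; omega⟩
  have h := omitsOnly_pathAlpha k.rev x.rev
  rw [ne_eq, Fin.rev_inj] at h
  rw [ne_eq, ← h]
  simp only [prefixReversal, mem_mul_pathTau, mem_pathTau_mul]
  exact ⟨fun ⟨y, hy⟩ => ⟨_, hy⟩, fun ⟨y, hy⟩ => ⟨y.rev, by rwa [Fin.rev_rev]⟩⟩

theorem pathAlpha_mul_prefixReversal_comm :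
    pathAlpha k * prefixReversal k = prefixReversal k * pathAlpha k := by
  refine PEquiv.ext_mem fun x y => ?_
  simp only [PEquiv.mem_mul_iff]
  constructor
  · rintro ⟨z, hz, hy⟩
    obtain ⟨w, hw⟩ := (isInvolutionOff_prefixReversal.1 x).2
      ((omitsOnly_pathAlpha k x).1 ⟨z, hz⟩)
    refine ⟨w, hw, ?_⟩
    rw [mem_pathAlpha, mem_prefixReversal] at *
    omega
  · rintro ⟨z, hz, hy⟩
    obtain ⟨w, hw⟩ := (omitsOnly_pathAlpha k x).2
      ((isInvolutionOff_prefixReversal.1 x).1 ⟨z, hz⟩)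
    refine ⟨w, hw, ?_⟩
    rw [mem_prefixReversal, mem_pathAlpha] at *
    omega

theorem isInvolutionOff_mul {f : Fin n ≃. Fin n} (he : IsInvolutionOff k e)
    (hf : IsInvolutionOff k f) (h : e * f = f * e) : IsInvolutionOff k (e * f) := by
  constructor
  · intro x
    rw [← he.1 x]
    refine ⟨PEquiv.exists_mem_of_mul, fun ⟨z, hz⟩ => ?_⟩
    obtain ⟨y, hy⟩ := (hf.1 z).2 ((he.range z).1 ⟨x, hz⟩)
    exact ⟨y, PEquiv.mem_mul_iff.2 ⟨z, hz, hy⟩⟩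
  · intro x y hxy
    obtain ⟨z, hz, hy⟩ := PEquiv.mem_mul_iff.1 hxy
    rw [h]
    exact PEquiv.mem_mul_iff.2 ⟨z, hf.2 _ _ hy, he.2 _ _ hz⟩

variable (k) in
/-- The four partial automorphisms that preserve both sides of `k`, undefined at `k`. -/
def flipSet : Set (Fin n ≃. Fin n) :=
  {pathAlpha k * pathAlpha k, pathAlpha k, prefixReversal k, pathAlpha k * prefixReversal k}

theorem isInvolutionOff_of_mem_flipSet (h : e ∈ flipSet k) : IsInvolutionOff k e := by
  rcases h with rfl | rfl | rfl | rfl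
  · exact isInvolutionOff_idem
  · exact isInvolutionOff_pathAlpha
  · exact isInvolutionOff_prefixReversal
  · exact isInvolutionOff_mul isInvolutionOff_pathAlpha isInvolutionOff_prefixReversal
      pathAlpha_mul_prefixReversal_comm

theorem pathAlpha_mul_mem_flipSet (h : e ∈ flipSet k) : pathAlpha k * e ∈ flipSet k := by
  rcases h with rfl | rfl | rfl | rfl
  · rw [isInvolutionOff_pathAlpha.mul_idem]
    simp [flipSet]
  · simp [flipSet]
  · simp [flipSet]
  · rw [← mul_assoc, isInvolutionOff_prefixReversal.idem_mul]
    simp [flipSet]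

theorem prefixReversal_mul_mem_flipSet (h : e ∈ flipSet k) :
    prefixReversal k * e ∈ flipSet k := by
  rcases h with rfl | rfl | rfl | rfl
  · rw [isInvolutionOff_prefixReversal.mul_idem]
    simp [flipSet]
  · rw [← pathAlpha_mul_prefixReversal_comm]
    simp [flipSet]
  · rw [isInvolutionOff_prefixReversal.mul_self]
    simp [flipSet]
  · rw [pathAlpha_mul_prefixReversal_comm, ← mul_assoc, isInvolutionOff_prefixReversal.mul_self,
      isInvolutionOff_pathAlpha.idem_mul]
    simp [flipSet]

theorem pathAlpha_rev_eq : pathAlpha k.rev = pathTau n * prefixReversal k * pathTau n := by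
  rw [prefixReversal, ← mul_assoc, ← mul_assoc, pathTau_mul_self, one_mul, mul_assoc,
    pathTau_mul_self, mul_one]

/-- Classification of the partial automorphisms of corank one undefined at `k` or its mirror
image. -/
theorem exists_flip_of_mem_PAut (hn : 3 ≤ n) (hk : k ≠ k.rev) {f : Fin n ≃. Fin n}
    (hf : f ∈ PAut (pathGraph n)) {d : Fin n} (hdk : d = k ∨ d = k.rev) (hd : f.OmitsOnly d) :
    ∃ p e q : Fin n ≃. Fin n, (p = 1 ∨ p = pathTau n) ∧ e ∈ flipSet k ∧
      (q = 1 ∨ q = pathTau n) ∧ f = p * e * q := by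
  rw [← closure_pathSetA hn] at hf
  induction hf using Submonoid.closure_induction_left generalizing d with
  | one => exact absurd (fun x => ⟨x, PEquiv.mem_one_iff.2 rfl⟩) hd.not_isTotal
  | mul_left g hg f hf ih =>
    rw [pathSetA_eq] at hg
    rcases hg with rfl | ⟨i, -, rfl⟩
    · obtain ⟨p, e, q, hp, he, hq, rfl⟩ := ih (d := d.rev)
        (by rcases hdk with rfl | rfl <;> simp) (omitsOnly_pathTau_mul.1 hd)
      refine ⟨pathTau n * p, e, q, ?_, he, hq, by simp only [mul_assoc]⟩
      rcases hp with rfl | rfl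
      · exact Or.inr (mul_one _)
      · exact Or.inl (pathTau_mul_self n)
    · obtain rfl := (omitsOnly_pathAlpha i).eq fun x hx =>
        PEquiv.exists_mem_of_mul ((hd x).2 hx)
      rcases PEquiv.isTotal_or_of_mul fun x => (hd x).2 with ht | ⟨-, l, hl, hfl⟩
      · exact absurd ht (not_isTotal_pathAlpha d)
      obtain rfl : l = d := by
        by_contra hne
        exact (hl l).1 ((isInvolutionOff_pathAlpha.range l).2 hne) rfl
      rcases PEquiv.isTotal_or_omitsOnly hfl with ht | hfo
      · have hfE : f ∈ IEnd (pathGraph n) :=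
          PAut_le_IEnd _ (closure_pathSetA hn ▸ hf)
        have hf' := eq_one_or_eq_pathTau hn hfE ht
        rcases hdk with rfl | rfl
        · exact ⟨1, pathAlpha l, f, Or.inl rfl, by simp [flipSet], hf', by rw [one_mul]⟩
        · refine ⟨pathTau n, prefixReversal k, pathTau n * f, Or.inr rfl, by simp [flipSet],
            ?_, by rw [pathAlpha_rev_eq]; simp only [mul_assoc]⟩
          rcases hf' with rfl | rfl
          · exact Or.inr (mul_one _)
          · exact Or.inl (pathTau_mul_self n)
      · obtain ⟨p, e, q, hp, he, hq, rfl⟩ := ih hdk hfo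
        have hek := (isInvolutionOff_of_mem_flipSet he).1
        rcases hdk with rfl | rfl
        · rcases hp with rfl | rfl
          · exact ⟨1, pathAlpha l * e, q, Or.inl rfl, pathAlpha_mul_mem_flipSet he, hq,
              by simp only [one_mul, mul_assoc]⟩
          · rw [mul_assoc, omitsOnly_pathTau_mul] at hfo
            refine absurd (hek.eq fun x hx => PEquiv.exists_mem_of_mul ((hfo x).2 hx))
              hk.symm
        · rcases hp with rfl | rfl
          · rw [one_mul] at hfo
            exact absurd (hek.eq fun x hx => PEquiv.exists_mem_of_mul ((hfo x).2 hx))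
              hk.symm
          · refine ⟨pathTau n, prefixReversal k * e, q, Or.inr rfl,
              prefixReversal_mul_mem_flipSet he, hq, ?_⟩
            rw [pathAlpha_rev_eq]
            simp only [mul_assoc]
            rw [← mul_assoc (pathTau n) (pathTau n), pathTau_mul_self, one_mul]

theorem eq_one_of_omitsOnly (hk : k ≠ k.rev) {p q : Fin n ≃. Fin n} (hp : p = 1 ∨ p = pathTau n)
    (he : IsInvolutionOff k e) (h : (p * e * q).OmitsOnly k) : p = 1 := by
  refine hp.resolve_right ?_
  rintro rfl
  rw [mul_assoc, omitsOnly_pathTau_mul] at h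
  exact hk.symm (he.1.eq fun x hx => PEquiv.exists_mem_of_mul ((h x).2 hx))

theorem eq_pathTau_of_omitsOnly (hk : k ≠ k.rev) {p q : Fin n ≃. Fin n}
    (hp : p = 1 ∨ p = pathTau n) (he : IsInvolutionOff k e)
    (h : (p * e * q).OmitsOnly k.rev) : p = pathTau n := by
  refine hp.resolve_left ?_
  rintro rfl
  rw [one_mul] at h
  exact hk.symm (he.1.eq fun x hx => PEquiv.exists_mem_of_mul ((h x).2 hx))

theorem range_mul_eq {p q : Fin n ≃. Fin n} (hp : p = 1 ∨ p = pathTau n)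
    (he : IsInvolutionOff k e) (y : Fin n) :
    ((∃ x, y ∈ (p * e * q) x) ↔ ∃ z, z ≠ k ∧ y ∈ q z) := by
  constructor
  · rintro ⟨x, hx⟩
    obtain ⟨z, hz, hy⟩ := PEquiv.mem_mul_iff.1 hx
    obtain ⟨w, hw, hz⟩ := PEquiv.mem_mul_iff.1 hz
    exact ⟨z, (he.range z).1 ⟨w, hz⟩, hy⟩
  · rintro ⟨z, hz, hy⟩
    obtain ⟨w, hw⟩ := (he.range z).2 hz
    have hpt : p.IsTotal := by
      rcases hp with rfl | rfl
      · exact fun x => ⟨x, PEquiv.mem_one_iff.2 rfl⟩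
      · exact isTotal_pathTau n
    obtain ⟨x, hx⟩ := hpt.surjective w
    exact ⟨x, PEquiv.mem_mul_iff.2 ⟨z, PEquiv.mem_mul_iff.2 ⟨w, hx, hw⟩, hy⟩⟩

/-- A single generator `p₀ * e₀ * q₀` of the class would yield only the flips `e₀` and the
idempotent. But both sides of `k` have at least two vertices, so the reversals of the two sides are
distinct nontrivial flips. -/
theorem exists_ne_of_closure_eq_PAut (hn : 3 ≤ n) (hk : 2 ≤ k.val) (hk' : 2 * k.val + 1 < n)
    {H : Set (Fin n ≃. Fin n)} (hH : Submonoid.closure H = PAut (pathGraph n)) :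
    ∃ g ∈ H, ∃ g' ∈ H, g ≠ g' ∧ (g.OmitsOnly k ∨ g.OmitsOnly k.rev) ∧
      (g'.OmitsOnly k ∨ g'.OmitsOnly k.rev) := by
  by_contra! hcon
  have hkr : k ≠ k.rev := by
    rw [ne_eq, Fin.ext_iff, Fin.val_rev]
    omega
  have hHP : H ⊆ PAut (pathGraph n) := hH ▸ Submonoid.subset_closure
  have hHE : H ⊆ IEnd (pathGraph n) := fun g hg => (hHP hg).1
  obtain ⟨g₀, hg₀, hg₀k⟩ := exists_omitsOnly_mem hn hHE (f := pathAlpha k)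
    (hH ▸ pathAlpha_mem_PAut k) (omitsOnly_pathAlpha k)
  have huniq : ∀ g ∈ H, g.OmitsOnly k ∨ g.OmitsOnly k.rev → g = g₀ := by
    intro g hg hgk
    by_contra hne
    have := hcon g hg g₀ hg₀ hne hgk
    rcases hg₀k with h | h
    · exact this.1 h
    · exact this.2 h
  obtain ⟨p₀, e₀, q₀, hp₀, he₀, hq₀, hg₀eq⟩ : ∃ p e q : Fin n ≃. Fin n,
      (p = 1 ∨ p = pathTau n) ∧ e ∈ flipSet k ∧ (q = 1 ∨ q = pathTau n) ∧ g₀ = p * e * q := by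
    rcases hg₀k with h | h
    · exact exists_flip_of_mem_PAut hn hkr (hHP hg₀) (Or.inl rfl) h
    · exact exists_flip_of_mem_PAut hn hkr (hHP hg₀) (Or.inr rfl) h
  have hi₀ := isInvolutionOff_of_mem_flipSet he₀
  have key : ∀ f ∈ Submonoid.closure H, ∀ d, (d = k ∨ d = k.rev) → f.OmitsOnly d →
      ∃ p e q : Fin n ≃. Fin n, (p = 1 ∨ p = pathTau n) ∧
        (e = pathAlpha k * pathAlpha k ∨ e = e₀) ∧ (q = 1 ∨ q = pathTau n) ∧ f = p * e * q := by
    intro f hf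
    induction hf using Submonoid.closure_induction_left with
    | one =>
      intro d _ hd
      exact absurd (fun x => ⟨x, PEquiv.mem_one_iff.2 rfl⟩) hd.not_isTotal
    | mul_left g hg f hf ih =>
      intro d hdk hd
      rcases PEquiv.isTotal_or_of_mul fun x => (hd x).2 with ht | ⟨hgo, l, hl, hfl⟩
      · rcases eq_one_or_eq_pathTau hn (hHE hg) ht with rfl | rfl
        · rw [one_mul] at hd ⊢
          exact ih d hdk hd
        · obtain ⟨p, e, q, hp, he, hq, rfl⟩ := ih d.rev
            (by rcases hdk with rfl | rfl <;> simp) (omitsOnly_pathTau_mul.1 hd)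
          refine ⟨pathTau n * p, e, q, ?_, he, hq, by simp only [mul_assoc]⟩
          rcases hp with rfl | rfl
          · exact Or.inr (mul_one _)
          · exact Or.inl (pathTau_mul_self n)
      · have hgg : g = g₀ := huniq g hg (by
          rcases hdk with rfl | rfl
          · exact Or.inl hgo
          · exact Or.inr hgo)
        have hlk : l = k ∨ l = k.rev := by
          have := eq_or_eq_rev_of_range hn (hHP hg) hgo hl
          rcases hdk with rfl | rfl
          · exact this
          · rwa [Fin.rev_rev, or_comm] at this
        rw [hgg, hg₀eq] at hl ⊢
        have hrange := fun y => (range_mul_eq (q := q₀) hp₀ hi₀ y).symm.trans (hl y)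
        rcases PEquiv.isTotal_or_omitsOnly hfl with ht | hfo
        · have hfE : f ∈ IEnd (pathGraph n) := PAut_le_IEnd _ (hH ▸ hf)
          refine ⟨p₀, e₀, q₀ * f, hp₀, Or.inr rfl, ?_, by simp only [mul_assoc]⟩
          rcases eq_one_or_eq_pathTau hn hfE ht with rfl | rfl
          · rwa [mul_one]
          · rcases hq₀ with rfl | rfl
            · exact Or.inr (one_mul _)
            · exact Or.inl (pathTau_mul_self n)
        · obtain ⟨p, e, q, hp, he, hq, rfl⟩ := ih l hlk hfo
          have hi : IsInvolutionOff k e := by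
            rcases he with rfl | rfl
            · exact isInvolutionOff_idem
            · exact hi₀
          -- The vertex `l` missing from the range of the generator is the one missing from the
          -- domain of the rest, so the inner factors τ cancel in pairs.
          have hqp : q₀ * p = 1 := by
            rcases hq₀ with rfl | rfl
            · obtain rfl : l = k := by
                by_contra hne
                obtain ⟨z, hz, hz'⟩ := (hrange k).2 (Ne.symm hne)
                exact hz (PEquiv.mem_one_iff.1 hz').symm
              rw [one_mul]
              exact eq_one_of_omitsOnly hkr hp hi hfo
            · obtain rfl : l = k.rev := by
                by_contra hne
                obtain ⟨z, hz, hz'⟩ := (hrange k.rev).2 (Ne.symm hne)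
                rw [mem_pathTau, Fin.val_rev] at hz'
                exact hz (Fin.ext (by omega))
              rw [eq_pathTau_of_omitsOnly hkr hp hi hfo, pathTau_mul_self]
          refine ⟨p₀, e₀ * e, q, hp₀, ?_, hq, ?_⟩
          · rcases he with rfl | rfl
            · exact Or.inr hi₀.mul_idem
            · exact Or.inl hi₀.mul_self
          · calc p₀ * e₀ * q₀ * (p * e * q) = p₀ * e₀ * (q₀ * p) * (e * q) := by
                  simp only [mul_assoc]
              _ = p₀ * (e₀ * e) * q := by
                  rw [hqp, mul_one]
                  simp only [mul_assoc]
  have inv : ∀ f ∈ PAut (pathGraph n), IsInvolutionOff k f → f ≠ pathAlpha k * pathAlpha k →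
      f = e₀ := by
    intro f hf hfi hne
    obtain ⟨p, e, q, hp, he, hq, rfl⟩ := key f (hH ▸ hf) k (Or.inl rfl) hfi.1
    have hi : IsInvolutionOff k e := by
      rcases he with rfl | rfl
      · exact isInvolutionOff_idem
      · exact hi₀
    obtain rfl := eq_one_of_omitsOnly hkr hp hi hfi.1
    have hq1 : q = 1 := by
      refine hq.resolve_right ?_
      rintro rfl
      have h1 := (range_mul_eq hp hi k).symm.trans (hfi.range k)
      exact h1.1 ⟨k.rev, hkr.symm, mem_pathTau.2 (by rw [Fin.val_rev]; omega)⟩ rfl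
    subst hq1
    rw [one_mul, mul_one] at hne ⊢
    exact he.resolve_left hne
  have hz : (⟨k.val - 1, by omega⟩ : Fin n) ∈ prefixReversal k ⟨0, by omega⟩ :=
    mem_prefixReversal.2 (Or.inl ⟨by simp only; omega, by simp only; omega⟩)
  have hn1 : (⟨k.val + 1, by omega⟩ : Fin n) ∈ pathAlpha k ⟨n - 1, by omega⟩ :=
    mem_pathAlpha.2 (Or.inr ⟨by simp only; omega, by simp only; omega⟩)
  have h1 := inv _ (pathAlpha_mem_PAut k) isInvolutionOff_pathAlpha fun h => by
    rw [h, mem_pathAlpha_mul_self, Fin.ext_iff] at hn1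
    simp only at hn1
    omega
  have h2 := inv (prefixReversal k)
    (mul_mem (mul_mem (pathTau_mem_PAut n) (pathAlpha_mem_PAut _)) (pathTau_mem_PAut n))
    isInvolutionOff_prefixReversal fun h => by
      rw [h, mem_pathAlpha_mul_self, Fin.ext_iff] at hz
      simp only at hz
      omega
  rw [h2, ← h1, mem_pathAlpha] at hz
  simp only at hz
  omega

end

/-! ### Counting generators. -/

theorem encard_diff_PAut_ge {n : ℕ} (hn : 3 ≤ n) {S : Set (Fin n ≃. Fin n)}
    (hS : Submonoid.closure S = IEnd (pathGraph n)) :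
    (((n + 1) / 2 - 1 : ℕ) : ℕ∞) ≤ (S \ (PAut (pathGraph n) : Set (Fin n ≃. Fin n))).encard := by
  have hSE : S ⊆ IEnd (pathGraph n) := hS ▸ Submonoid.subset_closure
  -- The vertices `i + 1` represent the mirror classes of inner vertices.
  have hex : ∀ i : Fin ((n + 1) / 2 - 1), ∃ g ∈ S, g ∉ PAut (pathGraph n) ∧
      (g.OmitsOnly ⟨i.val + 1, by omega⟩ ∨
        g.OmitsOnly (⟨i.val + 1, by omega⟩ : Fin n).rev) := fun i =>
    exists_omitsOnly_notMem_PAut hn hSE (hS ▸ isPartialEnd_pathBeta _)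
      (pathBeta_notMem_PAut (by simp only; omega) (by simp only; omega)) (omitsOnly_pathBeta _)
  choose g hgS hgP hg using hex
  have h := Set.encard_le_encard_of_injOn (s := Set.univ) (f := g)
    (t := S \ (PAut (pathGraph n) : Set (Fin n ≃. Fin n))) (fun i _ => ⟨hgS i, hgP i⟩) ?_
  · simpa using h
  · intro i _ j _ hij
    have hi := hg i
    have hj := hg j
    rw [hij] at hi
    rcases hi with hi | hi <;> rcases hj with hj | hj
    all_goals
      have := hi.eq fun x => (hj x).2
      simp only [Fin.ext_iff, Fin.val_rev] at this ⊢
      omega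

theorem encard_inter_PAut_ge {n : ℕ} (hn : 3 ≤ n) {H : Set (Fin n ≃. Fin n)}
    (hH : Submonoid.closure H = PAut (pathGraph n)) :
    ((alphaCount n + 1 : ℕ) : ℕ∞) ≤ H.encard := by
  have hHE : H ⊆ IEnd (pathGraph n) := fun g hg =>
    PAut_le_IEnd _ (hH ▸ Submonoid.subset_closure hg)
  have hex : ∀ k : Fin n, ∃ g g' : Fin n ≃. Fin n,
      (g ∈ H ∧ (g.OmitsOnly k ∨ g.OmitsOnly k.rev)) ∧ (2 ≤ k.val → 2 * k.val + 1 < n →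
        g' ∈ H ∧ g ≠ g' ∧ (g'.OmitsOnly k ∨ g'.OmitsOnly k.rev)) := by
    intro k
    by_cases hk : 2 ≤ k.val ∧ 2 * k.val + 1 < n
    · obtain ⟨g, hg, g', hg', hne, ho, ho'⟩ := exists_ne_of_closure_eq_PAut hn hk.1 hk.2 hH
      exact ⟨g, g', ⟨hg, ho⟩, fun _ _ => ⟨hg', hne, ho'⟩⟩
    · obtain ⟨g, hg, ho⟩ := exists_omitsOnly_mem hn hHE (f := pathAlpha k)
        (hH ▸ pathAlpha_mem_PAut k) (omitsOnly_pathAlpha k)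
      exact ⟨g, g, ⟨hg, ho⟩, fun h h' => absurd ⟨h, h'⟩ hk⟩
  choose g g' hg hg' using hex
  have hle : alphaCount n + 1 ≤ n := by
    unfold alphaCount
    split_ifs <;> omega
  have hlarge : ∀ i, i < alphaCount n → ¬ 2 * i + 1 ≤ n → i + 3 ≤ n := by
    unfold alphaCount
    intro i
    split_ifs <;> omega
  -- An index up to the centre takes the first generator of its class, an index beyond it the second
  -- generator of the mirror class. In the latter case `i < n - 2` makes the mirror index at least
  -- 2, so a second one exists.
  let F : Fin (alphaCount n) → (Fin n ≃. Fin n) := fun i =>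
    if 2 * i.val + 1 ≤ n then g ⟨i.val, by omega⟩ else g' ⟨n - 1 - i.val, by omega⟩
  have hF : ∀ i, F i ∈ H ∧ ((F i).OmitsOnly ⟨i.val, by omega⟩ ∨
      (F i).OmitsOnly (⟨i.val, by omega⟩ : Fin n).rev) := by
    intro i
    have hi := hlarge i.val i.isLt
    simp only [F]
    split_ifs with h
    · exact hg _
    · have h3 := hg' ⟨n - 1 - i.val, by omega⟩ (by simp only; omega) (by simp only; omega)
      have hrev : (⟨n - 1 - i.val, by omega⟩ : Fin n) = (⟨i.val, by omega⟩ : Fin n).rev :=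
        Fin.ext (by rw [Fin.val_rev]; simp only; omega)
      refine ⟨h3.1, ?_⟩
      have h4 := h3.2.2
      rw [hrev, Fin.rev_rev, or_comm] at h4
      rwa [hrev]
  have hinj : Function.Injective F := by
    have key : ∀ i j, 2 * i.val + 1 ≤ n → ¬ 2 * j.val + 1 ≤ n → i.val + j.val + 1 = n →
        F i ≠ F j := by
      intro i j hi hj hij
      have h1 := hlarge j.val j.isLt hj
      have h2 : (⟨n - 1 - j.val, by omega⟩ : Fin n) = ⟨i.val, by omega⟩ :=
        Fin.ext (by simp only; omega)
      simp only [F, if_pos hi, if_neg hj, h2]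
      exact (hg' ⟨i.val, by omega⟩ (by simp only; omega) (by simp only; omega)).2.1
    intro i j hij
    have hsum : i.val = j.val ∨ i.val + j.val + 1 = n := by
      have hi := (hF i).2
      have hj := (hF j).2
      rw [hij] at hi
      rcases hi with hi | hi <;> rcases hj with hj | hj
      all_goals
        have := hi.eq fun x => (hj x).2
        simp only [Fin.ext_iff, Fin.val_rev] at this
        omega
    rcases hsum with h | h
    · exact Fin.ext h
    by_cases h1 : 2 * i.val + 1 ≤ n
    · by_cases h2 : 2 * j.val + 1 ≤ n
      · exact Fin.ext (by omega)
      · exact absurd hij (key i j h1 h2 h)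
    · by_cases h2 : 2 * j.val + 1 ≤ n
      · exact absurd hij.symm (key j i h2 h1 (by omega))
      · exact Fin.ext (by omega)
  obtain ⟨t, htH, ht⟩ := exists_isTotal_mem hn (S := H) (hH ▸ pathTau_mem_PAut n)
  have hnot : t ∉ Set.range F := by
    rintro ⟨i, rfl⟩
    rcases (hF i).2 with h | h
    · exact h.not_isTotal ht
    · exact h.not_isTotal ht
  have hsub : insert t (Set.range F) ⊆ H := by
    rintro f (rfl | ⟨i, rfl⟩)
    · exact htH
    · exact (hF i).1
  have hcard : (Set.range F).encard = alphaCount n := by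
    rw [← Set.image_univ, hinj.encard_image]
    simp
  have := Set.encard_le_encard hsub
  rw [Set.encard_insert_of_notMem hnot, hcard] at this
  exact_mod_cast this

theorem encard_ge_of_closure_eq_IEnd {n : ℕ} (hn : 3 ≤ n) {S : Set (Fin n ≃. Fin n)}
    (hS : Submonoid.closure S = IEnd (pathGraph n)) :
    ((alphaCount n + 1 + ((n + 1) / 2 - 1) : ℕ) : ℕ∞) ≤ S.encard := by
  rw [← Set.encard_sdiff_add_encard_inter S (PAut (pathGraph n) : Set (Fin n ≃. Fin n)), Nat.cast_add]
  exact (add_le_add (encard_inter_PAut_ge hn (closure_inter_PAut hn hS))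
    (encard_diff_PAut_ge hn hS)).trans_eq (add_comm _ _)

theorem encard_pathSetB_le {n : ℕ} (hn : 3 ≤ n) :
    (pathSetB n).encard ≤ ((alphaCount n + 1 + ((n + 1) / 2 - 1) : ℕ) : ℕ∞) := by
  have hle : alphaCount n ≤ n := by
    unfold alphaCount
    split_ifs <;> omega
  have hsub : pathSetB n ⊆ {pathTau n} ∪
      Set.range (fun i : Fin (alphaCount n) => pathAlpha (⟨i.val, by omega⟩ : Fin n)) ∪
      Set.range (fun i : Fin ((n + 1) / 2 - 1) => pathBeta (⟨i.val + 1, by omega⟩ : Fin n)) := by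
    unfold pathSetB
    rw [pathSetA_eq, natCeil_half]
    refine Set.union_subset_union (Set.union_subset_union_right _ ?_) ?_
    · rintro f ⟨i, hi, rfl⟩
      exact ⟨⟨i.val, by omega⟩, rfl⟩
    · rintro f ⟨i, hi, hi', rfl⟩
      refine ⟨⟨i.val - 1, by omega⟩, ?_⟩
      exact congrArg pathBeta (Fin.ext (show i.val - 1 + 1 = i.val by omega))
  have hr : ∀ {m : ℕ} (g : Fin m → (Fin n ≃. Fin n)), (Set.range g).encard ≤ m := fun g => by
    rw [← Set.image_univ]
    exact (Set.encard_image_le _ _).trans (by simp)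
  refine (Set.encard_le_encard hsub).trans ((Set.encard_union_le _ _).trans ?_)
  rw [Nat.cast_add]
  refine add_le_add ((Set.encard_union_le _ _).trans ?_) (hr _)
  rw [Set.encard_singleton, add_comm, Nat.cast_add, Nat.cast_one]
  exact add_le_add (hr _) le_rfl

/-! ### The rank. -/

/-- The rank of a submonoid, in terms of the subsets of the ambient monoid generating it. -/
theorem monoidRank_submonoid {M : Type*} [Monoid M] (N : Submonoid M) :
    monoidRank N = ⨅ (S : Set M) (_ : Submonoid.closure S = N), S.encard := by
  refine le_antisymm (le_iInf₂ fun S hS => ?_) (le_iInf₂ fun S hS => ?_)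
  · have hSN : S ⊆ Set.range N.subtype := by
      rw [Submonoid.coe_subtype, Subtype.range_coe]
      exact hS ▸ Submonoid.subset_closure
    have himg : N.subtype '' (N.subtype ⁻¹' S) = S := Set.image_preimage_eq_of_subset hSN
    refine (iInf₂_le (N.subtype ⁻¹' S) ?_).trans ?_
    · apply Submonoid.map_injective_of_injective (f := N.subtype) N.subtype_injective
      rw [MonoidHom.map_mclosure, himg, hS, ← MonoidHom.mrange_eq_map, Submonoid.mrange_subtype]
    · rw [← N.subtype_injective.encard_image, himg]
  · refine (iInf₂_le (N.subtype '' S) ?_).trans (N.subtype_injective.encard_image S).le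
    rw [← MonoidHom.map_mclosure, hS, ← MonoidHom.mrange_eq_map, Submonoid.mrange_subtype]

theorem monoidRank_IEnd_pathGraph {n : ℕ} (hn : 3 ≤ n) :
    monoidRank (IEnd (pathGraph n)) = ((alphaCount n + 1 + ((n + 1) / 2 - 1) : ℕ) : ℕ∞) := by
  rw [monoidRank_submonoid]
  exact le_antisymm ((iInf₂_le (pathSetB n) (closure_pathSetB hn)).trans (encard_pathSetB_le hn))
    (le_iInf₂ fun S hS => encard_ge_of_closure_eq_IEnd hn hS)

theorem theorem3 :
    monoidRank (IEnd (SimpleGraph.pathGraph 3)) = 4 ∧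
    (∀ n : ℕ, 4 ≤ n →
      monoidRank (IEnd (SimpleGraph.pathGraph n)) = ((n + ⌈(n : ℚ) / 2⌉₊ - 2 : ℕ) : ℕ∞)) ∧
    (∀ n : ℕ, 3 ≤ n →
      Submonoid.closure (pathSetB n) = IEnd (SimpleGraph.pathGraph n) ∧
      (pathSetB n).encard = monoidRank (IEnd (SimpleGraph.pathGraph n)) ∧
      ∀ G' : Set (Fin n ≃. Fin n),
        Submonoid.closure G' = IEnd (SimpleGraph.pathGraph n) →
          Submonoid.closure (G' ∩ (PAut (SimpleGraph.pathGraph n) : Set (Fin n ≃. Fin n))) =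
            PAut (SimpleGraph.pathGraph n) ∧
          ((⌈(n : ℚ) / 2⌉₊ - 1 : ℕ) : ℕ∞) ≤
            (G' \ (PAut (SimpleGraph.pathGraph n) : Set (Fin n ≃. Fin n))).encard) := by
  refine ⟨?_, fun n hn => ?_, fun n hn => ⟨closure_pathSetB hn, ?_, fun S hS =>
    ⟨closure_inter_PAut hn hS, ?_⟩⟩⟩
  · rw [monoidRank_IEnd_pathGraph le_rfl]
    rfl
  · rw [monoidRank_IEnd_pathGraph (by omega), natCeil_half, alphaCount, if_neg (by omega)]
    congr 1
    omega
  · rw [monoidRank_IEnd_pathGraph hn]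
    exact le_antisymm (encard_pathSetB_le hn)
      (encard_ge_of_closure_eq_IEnd hn (closure_pathSetB hn))
  · rw [natCeil_half]
    exact encard_diff_PAut_ge hn hS
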